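/- **Model.** Fix integers $K,m,n$, a target $y^*\in\mathbb R^m$, a compact convex set $\Pi\subset\mathbb R^n$, a compact set $\Theta\subset\mathbb R^{K\times m\times(n+1)}$ and $\sigma_w>0$. A model consists of $\theta=(A_k,b_k)_{k=1}^K$ with $A_k\in\mathbb R^{m\times n}$, $b_k\in\mathbb R^m$, a stochastic matrix $P=[p_{i,j}]$ on $\{1,\dots,K\}$, an initial distribution, and noise distributions $f_1,\dots,f_K$ on $\mathbb R^m$. The states $s_0,s_1,\dots$ form a Markov chain with transition matrix $P$ and the given initial distribution; the output at time $t\ge1$ is $$y_t=A_{s_t}x_t+b_{s_t}+w_t ,$$ where, given the states, the $w_t$ are independent with $w_t\sim f_{s_t}$. The stage cost is $J(s_{t-1},x_t)=\mathbb E(\|y^*-y_t\|_2^2\mid s_{t-1},x_t)$, that is, $J(i,x)=\sum_j p_{i,j}\int\|y^*-A_jx-b_j-w\|_2^2\,f_j(dw)$, and the optimal input after state $i$ is $$x_i^*=\Bigl(\sum_j p_{i,j}A_j^{\mathsf T}A_j\Bigr)^{-1}\sum_j p_{i,j}A_j^{\mathsf T}(y^*-b_j).$$ A model is admissible if $\theta\in\Theta$,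 every $A_k$ has full column rank, $x_i^*\in\Pi$ for every $i$, and every entry of $w\sim f_k$ has mean zero and satisfies $\mathbb E(w_l^2)\le\sigma_w^2$ and $\mathbb E(w_l^4)\le\sigma_w^4$, for every $k$. **Policy (MSPSA).** For each state $i$ fix $\gamma_i,\gamma_i'>0$, integers $N_i,N_i'\ge0$ and $\hat x_{i,1}\in\Pi$; put $a_{i,k}=\gamma_i/(N_i+k)$ and $c_{i,k}=\gamma_i'/(N_i'+k)^{1/4}$. Fix a probability distribution $\nu$ on $\mathbb R$, symmetric around zero, such that $\Delta\sim\nu$ satisfies $|\Delta|\le\xi_1$ almost surely and $\mathbb E(1/\Delta^2)\le\xi_2$, for some constants $\xi_1,\xi_2>0$. For every state $i$ the policy keeps a counter $t_i$ and a flag $e_i$, both initially $0$. At stage $t=1,2,\dots$, let $i=s_{t-1}$. * If $e_i=0$: increase $t_i$ by one, draw a fresh vector $\Delta_{i,t_i}\in\mathbb R^n$ with i.i.d. entries of law $\nu$ (independent of the model's randomness and of all other draws), apply $x_t=\hat x_{i,t_i}+c_{i,t_i}\Delta_{i,t_i}$, store $d^+=\|y_t-y^*\|_2^2$, and set $e_i=1$.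 * If $e_i=1$: apply $x_t=\hat x_{i,t_i}-c_{i,t_i}\Delta_{i,t_i}$, let $d^-=\|y_t-y^*\|_2^2$ (and let $d^+$ be the last value stored for $i$), set $e_i=0$ and $$\hat x_{i,t_i+1}=\mathrm{proj}_\Pi\Bigl(\hat x_{i,t_i}-a_{i,t_i}\,\frac{d^+-d^-}{c_{i,t_i}}\,\bar\Delta_{i,t_i}\Bigr),$$ where $\bar\Delta$ is the vector of reciprocals of the entries of $\Delta$ and $\mathrm{proj}_\Pi$ is the Euclidean projection onto $\Pi$. **Worst case.** Let $\mathcal M$ be the class of all admissible models that satisfy $$\gamma_i\ \ge\ \frac{1}{8\,\lambda_{\min}\bigl(\sum_j p_{i,j}A_j^{\mathsf T}A_j\bigr)}\qquad\text{for every state } i,$$ and put $$\bar{\mathcal E}_T=\sup_{\mathcal M}\ \mathbb E\Bigl(\sum_{t=1}^T\|x_t-x^*_{s_{t-1}}\|_2^2\Bigr),\qquad \bar{\mathcal R}_T=\sup_{\mathcal M}\ \mathbb E\Bigl(\sum_{t=1}^T J(s_{t-1},x_t)-\sum_{t=1}^T J(s_{t-1},x^*_{s_{t-1}})\Bigr).$$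 **Theorem.** There are positive constants $C$ and $C'$ such that for every horizon $T$ the expectations above are well defined and finite for every model in $\mathcal M$, and $$\bar{\mathcal E}_T\le C\sqrt T,\qquad \bar{\mathcal R}_T\le C'\sqrt T .$$ The constants may depend on $K,m,n,y^*,\Pi,\Theta,\sigma_w$ and on the parameters of the policy, but not on $T$ or on the model in $\mathcal M$. -/

import Mathlib

open MeasureTheory ProbabilityTheory Finset

noncomputable section

namespace MSPSA

/-- Parameters `(θ, P, {f_i})` of a Markov jump affine model with state space `Fin K`, input space
`ℝⁿ` and output space `ℝᵐ`, together with the distribution `π₀` of the initial state `s₀`.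
State `k` carries the affine map `x ↦ A k x + b k` and the noise distribution `f k`. -/
structure JumpModel (K m n : ℕ) where
  A : Fin K → Matrix (Fin m) (Fin n) ℝ
  b : Fin K → EuclideanSpace ℝ (Fin m)
  P : Matrix (Fin K) (Fin K) ℝ
  P_nonneg : ∀ i j, 0 ≤ P i j
  P_sum : ∀ i, ∑ j, P i j = 1
  π₀ : Fin K → ℝ
  π₀_nonneg : ∀ i, 0 ≤ π₀ i
  π₀_sum : ∑ i, π₀ i = 1
  f : Fin K → Measure (EuclideanSpace ℝ (Fin m))
  f_prob : ∀ k, IsProbabilityMeasure (f k)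

variable {K m n : ℕ}

namespace JumpModel

/-- The noiseless output `A_k x + b_k` in state `k`. -/
def meanOutput (S : JumpModel K m n) (k : Fin K) (x : EuclideanSpace ℝ (Fin n)) :
    EuclideanSpace ℝ (Fin m) :=
  (S.A k).toEuclideanLin x + S.b k

/-- The quadratic stage cost `J(i, x) = 𝔼(‖y* - y_t‖² | s_{t-1} = i, x_t = x)`: the next state is
`j` with probability `p_{ij}` and then `y_t = A_j x + b_j + w` with `w ~ f_j`. -/
def stageCost (S : JumpModel K m n) (ystar : EuclideanSpace ℝ (Fin m)) (i : Fin K)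
    (x : EuclideanSpace ℝ (Fin n)) : ℝ :=
  ∑ j, S.P i j * ∫ w, ‖ystar - (S.meanOutput j x + w)‖ ^ 2 ∂(S.f j)

/-- The matrix `∑_j p_{ij} A_jᵀ A_j`. -/
def gram (S : JumpModel K m n) (i : Fin K) : Matrix (Fin n) (Fin n) ℝ :=
  ∑ j, S.P i j • ((S.A j).transpose * S.A j)

/-- The optimal input under the known model when the previous state is `i`:
`x_i^* = (∑_j p_{ij} A_jᵀ A_j)⁻¹ (∑_j p_{ij} A_jᵀ (y* - b_j))`. -/
def optimalInput (S : JumpModel K m n) (ystar : EuclideanSpace ℝ (Fin m)) (i : Fin K) :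
    EuclideanSpace ℝ (Fin n) :=
  (S.gram i)⁻¹.toEuclideanLin
    (∑ j, S.P i j • (S.A j).transpose.toEuclideanLin (ystar - S.b j))

end JumpModel

/-- The minimum eigenvalue of a real symmetric matrix (all of whose eigenvalues are real). -/
def lambdaMin (M : Matrix (Fin n) (Fin n) ℝ) : ℝ := sInf (spectrum ℝ M)

/-- The class of parameters over which the worst case is taken: `θ = (A_k, b_k)_k` lies in `Θ`,
every `A_k` has full column rank, the optimal inputs lie in the feasible set `F`, and the noise has
zero mean and entrywise second and fourth moments at most `σ²` and `σ⁴`. -/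
structure Admissible (ystar : EuclideanSpace ℝ (Fin m)) (F : Set (EuclideanSpace ℝ (Fin n)))
    (Θ : Set (Fin K → Matrix (Fin m) (Fin n) ℝ × EuclideanSpace ℝ (Fin m))) (σ : ℝ)
    (S : JumpModel K m n) : Prop where
  mem_Θ : (fun k => (S.A k, S.b k)) ∈ Θ
  rank_eq : ∀ k, (S.A k).rank = n
  optimalInput_mem : ∀ i, S.optimalInput ystar i ∈ F
  integrable : ∀ k l, Integrable (fun w => w l) (S.f k)
  mean_zero : ∀ k l, ∫ w, w l ∂(S.f k) = 0
  integrable_sq : ∀ k l, Integrable (fun w => w l ^ 2) (S.f k)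
  moment_two : ∀ k l, ∫ w, w l ^ 2 ∂(S.f k) ≤ σ ^ 2
  integrable_four : ∀ k l, Integrable (fun w => w l ^ 4) (S.f k)
  moment_four : ∀ k l, ∫ w, w l ^ 4 ∂(S.f k) ≤ σ ^ 4

/-- Design parameters of the MSPSA policy: step-size constants `γ_i > 0`, `N_i`, perturbation
constants `γ'_i > 0`, `N'_i`, initial estimates `x̂_{i,1}` in the feasible set `F`, and the common
distribution `ν` of the entries of the random perturbations, which is symmetric around zero,
bounded by `ξ₁`, and satisfies `𝔼(1/Δ²) ≤ ξ₂` (computed in `[0, ∞]`, with `1/0 = ∞`). -/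
structure Design (K : ℕ) {n : ℕ} (F : Set (EuclideanSpace ℝ (Fin n))) where
  γ : Fin K → ℝ
  γ_pos : ∀ i, 0 < γ i
  N : Fin K → ℕ
  γ' : Fin K → ℝ
  γ'_pos : ∀ i, 0 < γ' i
  N' : Fin K → ℕ
  init : Fin K → EuclideanSpace ℝ (Fin n)
  init_mem : ∀ i, init i ∈ F
  ν : Measure ℝ
  ν_prob : IsProbabilityMeasure ν
  ν_symm : ν.map (fun x => -x) = ν
  ξ₁ : ℝ
  ξ₁_pos : 0 < ξ₁
  ν_bound : ∀ᵐ x ∂ν, |x| ≤ ξ₁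
  ξ₂ : ℝ
  ξ₂_pos : 0 < ξ₂
  ν_inv_sq : ∫⁻ x, (ENNReal.ofReal (x ^ 2))⁻¹ ∂ν ≤ ENNReal.ofReal ξ₂

namespace Design

variable {F : Set (EuclideanSpace ℝ (Fin n))}

/-- Step size `a_k = γ_i / (N_i + k)`. -/
def stepSize (D : Design K F) (i : Fin K) (k : ℕ) : ℝ := D.γ i / (D.N i + k)

/-- Perturbation gain `c_k = γ'_i / (N'_i + k)^{1/4}`. -/
def gain (D : Design K F) (i : Fin K) (k : ℕ) : ℝ :=
  D.γ' i / ((D.N' i + k : ℝ) ^ (1 / 4 : ℝ))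

/-- The step-size condition `γ_i ≥ 1 / (8 λ_min(∑_j p_{ij} A_jᵀ A_j))` for every state `i`. -/
def StepSizeCondition (D : Design K F) (S : JumpModel K m n) : Prop :=
  ∀ i, D.γ i ≥ 1 / (8 * lambdaMin (S.gram i))

end Design

open Classical in
/-- Euclidean projection onto `F`: the point of `F` closest to `u` (it exists and is unique when
`F` is nonempty, compact and convex). -/
def proj (F : Set (EuclideanSpace ℝ (Fin n))) (u : EuclideanSpace ℝ (Fin n)) :
    EuclideanSpace ℝ (Fin n) :=
  if h : ∃ p ∈ F, ∀ q ∈ F, ‖u - p‖ ≤ ‖u - q‖ then h.choose else u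

/-- What the policy stores for one state `i`: the counter `t_i`, the flag `e_i`, the current
estimate `x̂_{i,t_i}`, the current perturbation `Δ_{t_i}`, and the observed cost `d⁺_{i,t_i}`. -/
structure Memory (n : ℕ) where
  count : ℕ
  flag : Bool
  est : EuclideanSpace ℝ (Fin n)
  pert : Fin n → ℝ
  dPlus : ℝ

namespace Design

variable {F : Set (EuclideanSpace ℝ (Fin n))}

/-- Memory before any observation. (Setting it up for all states at once is the same as setting it
up when a state is observed for the first time.) -/
def initMemory (D : Design K F) (i : Fin K) : Memory n where
  count := 0
  flag := false
  est := D.init i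
  pert := 0
  dPlus := 0

/-- The input when the previous state is `i`, the memory for `i` is `M`, and `δ` is a freshly
drawn perturbation vector (which is used only if the flag is `0`, that is, if no observation has
been taken yet with the current estimate). -/
def input (D : Design K F) (i : Fin K) (M : Memory n) (δ : Fin n → ℝ) :
    EuclideanSpace ℝ (Fin n) :=
  if M.flag = false then M.est + D.gain i (M.count + 1) • WithLp.toLp 2 δ
  else M.est - D.gain i M.count • WithLp.toLp 2 M.pert

/-- The memory for state `i` after the output `y` of that stage has been observed. -/
def update (D : Design K F) (ystar : EuclideanSpace ℝ (Fin m)) (i : Fin K) (M : Memory n)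
    (δ : Fin n → ℝ) (y : EuclideanSpace ℝ (Fin m)) : Memory n :=
  if M.flag = false then
    { count := M.count + 1
      flag := true
      est := M.est
      pert := δ
      dPlus := ‖y - ystar‖ ^ 2 }
  else
    { count := M.count
      flag := false
      est := proj F (M.est - (D.stepSize i M.count *
        ((M.dPlus - ‖y - ystar‖ ^ 2) / D.gain i M.count)) •
          WithLp.toLp 2 (fun l => 1 / M.pert l))
      pert := M.pert
      dPlus := M.dPlus }

end Design

/-- The random data of one stage `t`: the state `s_t`, the noise `w_t`, and the perturbation vector
drawn for stage `t`. -/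
abbrev Stage (K m n : ℕ) : Type := Fin K × EuclideanSpace ℝ (Fin m) × (Fin n → ℝ)

variable {F : Set (EuclideanSpace ℝ (Fin n))}

/-- The conditional distribution of `(s_t, w_t, Δ_t)` given the past with `s_{t-1} = i`:
`s_t = j` with probability `p_{ij}`, then `w_t ~ f_j`, and independently the entries of `Δ_t` are
i.i.d. with distribution `ν`. -/
def stageLaw (S : JumpModel K m n) (D : Design K F) (i : Fin K) : Measure (Stage K m n) :=
  ∑ j, ENNReal.ofReal (S.P i j) •
    (Measure.dirac j).prod ((S.f j).prod (Measure.pi fun _ : Fin n => D.ν))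

/-- The distribution of the data of stage `0`: `s_0 ~ π₀`; the other entries are never used. -/
def initLaw (S : JumpModel K m n) : Measure (Stage K m n) :=
  ∑ j, ENNReal.ofReal (S.π₀ j) • Measure.dirac (j, 0, 0)

theorem isProbabilityMeasure_stageLaw (S : JumpModel K m n) (D : Design K F) (i : Fin K) :
    IsProbabilityMeasure (stageLaw S D i) := by
  have h1 := S.f_prob
  have h2 := D.ν_prob
  constructor
  simp only [stageLaw, Measure.coe_finsetSum, Finset.sum_apply, Measure.smul_apply,
    measure_univ, smul_eq_mul, mul_one]
  rw [← ENNReal.ofReal_sum_of_nonneg (fun j _ => S.P_nonneg i j), S.P_sum, ENNReal.ofReal_one]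

/-- The one-step transition kernel, which depends on the past only through the last state. -/
def stageKernel (S : JumpModel K m n) (D : Design K F) (t : ℕ) :
    Kernel ((l : Finset.Iic t) → (fun _ : ℕ => Stage K m n) l) (Stage K m n) where
  toFun h := stageLaw S D (h ⟨t, Finset.mem_Iic.2 le_rfl⟩).1
  measurable' := (measurable_of_countable (stageLaw S D)).comp
    (measurable_fst.comp (measurable_pi_apply _))

instance (S : JumpModel K m n) (D : Design K F) (t : ℕ) : IsMarkovKernel (stageKernel S D t) :=
  ⟨fun _ => isProbabilityMeasure_stageLaw S D _⟩

/-- The joint law of the Markov chain, the noise and the perturbations `(s_t, w_t, Δ_t)_{t ≥ 0}`. -/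
def law (S : JumpModel K m n) (D : Design K F) : Measure (ℕ → Stage K m n) :=
  Kernel.trajMeasure (X := fun _ => Stage K m n) (initLaw S) (stageKernel S D)

section ClosedLoop

variable (S : JumpModel K m n) (D : Design K F) (ystar : EuclideanSpace ℝ (Fin m))
  (ω : ℕ → Stage K m n)

/-- The memory of the policy, for every state `i`, after `t` stages of the closed loop
`y_{t+1} = A_{s_{t+1}} x_{t+1} + b_{s_{t+1}} + w_{t+1}`. Only the memory for `s_t` changes. -/
def memory : ℕ → Fin K → Memory n
  | 0 => D.initMemory
  | t + 1 =>
    let i := (ω t).1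
    let x := D.input i (memory t i) (ω (t + 1)).2.2
    let y := S.meanOutput (ω (t + 1)).1 x + (ω (t + 1)).2.1
    Function.update (memory t) i (D.update ystar i (memory t i) (ω (t + 1)).2.2 y)

/-- The input `x_{t+1}` of the MSPSA policy at stage `t + 1`. -/
def policyInput (t : ℕ) : EuclideanSpace ℝ (Fin n) :=
  D.input (ω t).1 (memory S D ystar ω t (ω t).1) (ω (t + 1)).2.2

/-- `∑_{t=1}^T ‖x_t - x^*_{s_{t-1}}‖²` along one trajectory. -/
def inputError (T : ℕ) : ℝ :=
  ∑ t ∈ range T, ‖policyInput S D ystar ω t - S.optimalInput ystar (ω t).1‖ ^ 2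

/-- `∑_{t=1}^T J(s_{t-1}, x_t) - ∑_{t=1}^T J(s_{t-1}, x^*_{s_{t-1}})` along one trajectory. -/
def excessCost (T : ℕ) : ℝ :=
  ∑ t ∈ range T, S.stageCost ystar (ω t).1 (policyInput S D ystar ω t) -
    ∑ t ∈ range T, S.stageCost ystar (ω t).1 (S.optimalInput ystar (ω t).1)

end ClosedLoop

/-- The cumulative input-MSE `𝔼 (∑_{t=1}^T ‖x_t - x^*_{s_{t-1}}‖²)` of the MSPSA policy. -/
def inputMSE (D : Design K F) (ystar : EuclideanSpace ℝ (Fin m)) (T : ℕ) (S : JumpModel K m n) :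
    ℝ :=
  ∫ ω, inputError S D ystar ω T ∂(law S D)

/-- The `T`-period regret of the MSPSA policy. -/
def regret (D : Design K F) (ystar : EuclideanSpace ℝ (Fin m)) (T : ℕ) (S : JumpModel K m n) :
    ℝ :=
  ∫ ω, excessCost S D ystar ω T ∂(law S D)

/-- Supremum of a performance measure over a class of models (in the extended reals, so that an
unbounded family has supremum `∞`). -/
def worstCase (C : Set (JumpModel K m n)) (v : JumpModel K m n → ℝ) : EReal :=
  ⨆ S ∈ C, (v S : EReal)

end MSPSA

end

/-! The policy runs one stochastic approximation per state, and the argument reduces the closed loop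
to these separate recursions.

Decoupling. Given that the current state is `i`, the next state, noise and perturbation have the
fixed law `stageLaw S D i`, and only the memory of `i` changes. Let `value r M` be the expected
error of `r` independent visits to `i` from memory `M`. One stage spends one visit of the current
state's budget; giving the other states an extra visit only increases their values. So the error
incurred plus the total value left is at most, in expectation, the total value before
(`lintegral_errorAt_add_totalValue_le`). Iterating, the closed-loop error over `T` stages is at most
the sum over states of the error of `T` independent visits. No stopping times or visit counts are
needed.

One state. The cost is quadratic, so the mean of `d⁺ - d⁻` at fixed perturbation `δ` is exactly
`4c⟨δ, Gu⟩`, with `u` the error of the estimate and `G` the Gram matrix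
(`integral_outcomeCost_add_sub`). Multiplying by the reciprocals of `δ` and averaging turns this
into `4c Gu`, because `δ_l / δ_q` has mean one or zero. Projection does not increase the distance to
the optimum, so an update takes `‖u‖²` in mean to at most `‖u‖² - 8a⟨u, Gu⟩ + O(a²/c²)`. The
step-size condition makes the drift at least `‖u‖²/(N+k+1)` (`lintegral_estimate_update_le`).

Rates. Since `a²/c²` has order `k^(-3/2)`, the weight `N+k` telescopes the recursion and gives mean
square errors of order `k^(-1/2)` (`le_div_sqrt_of_recursion`). The exploration cost `c²` has the
same order, and both sum to `O(√T)`. All constants come from compactness and the moment bounds,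
hence are uniform over the class. The regret equals a quadratic form in the input error, so it is at
most a constant times the input error. -/

noncomputable section

namespace MSPSA

variable {K m n : ℕ}

/-! ### Euclidean projection onto a compact convex set -/

section Projection

variable {F : Set (EuclideanSpace ℝ (Fin n))}

theorem proj_spec (hF : IsCompact F) (hne : F.Nonempty) (u : EuclideanSpace ℝ (Fin n)) :
    proj F u ∈ F ∧ ∀ q ∈ F, ‖u - proj F u‖ ≤ ‖u - q‖ := by
  have h : ∃ p ∈ F, ∀ q ∈ F, ‖u - p‖ ≤ ‖u - q‖ := by
    obtain ⟨p, hp, hmin⟩ := hF.exists_isMinOn hne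
      (f := fun q => ‖u - q‖) (by fun_prop : Continuous fun q => ‖u - q‖).continuousOn
    exact ⟨p, hp, fun q hq => hmin hq⟩
  rw [proj, dif_pos h]
  exact h.choose_spec

theorem inner_sub_proj_le (hF : IsCompact F) (hconv : Convex ℝ F) (hne : F.Nonempty)
    (u : EuclideanSpace ℝ (Fin n)) {q : EuclideanSpace ℝ (Fin n)} (hq : q ∈ F) :
    inner ℝ (u - proj F u) (q - proj F u) ≤ 0 := by
  obtain ⟨hmem, hmin⟩ := proj_spec hF hne u
  refine (norm_eq_iInf_iff_real_inner_le_zero hconv hmem).1 ?_ q hq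
  have : Nonempty F := hne.to_subtype
  refine le_antisymm (le_ciInf fun w => hmin w w.2) ?_
  exact ciInf_le (f := fun w : F => ‖u - (w : EuclideanSpace ℝ (Fin n))‖)
    ⟨0, by rintro _ ⟨w, rfl⟩; exact norm_nonneg _⟩ ⟨proj F u, hmem⟩

/-- Adding the variational inequalities at `u` and `v` gives firm nonexpansiveness; Cauchy–Schwarz
finishes. -/
theorem norm_proj_sub_proj_le (hF : IsCompact F) (hconv : Convex ℝ F) (hne : F.Nonempty)
    (u v : EuclideanSpace ℝ (Fin n)) : ‖proj F u - proj F v‖ ≤ ‖u - v‖ := by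
  have h1 := inner_sub_proj_le hF hconv hne u (proj_spec hF hne v).1
  have h2 := inner_sub_proj_le hF hconv hne v (proj_spec hF hne u).1
  set p := proj F u
  set q := proj F v
  have key : ‖p - q‖ ^ 2 ≤ inner ℝ (u - v) (p - q) := by
    rw [← real_inner_self_eq_norm_sq]
    simp only [inner_sub_left, inner_sub_right, real_inner_comm] at h1 h2 ⊢
    linarith
  have h3 := key.trans (real_inner_le_norm (u - v) (p - q))
  by_contra! hlt
  nlinarith [norm_nonneg (u - v), norm_nonneg (p - q)]

theorem proj_of_mem (hF : IsCompact F) {q : EuclideanSpace ℝ (Fin n)} (hq : q ∈ F) :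
    proj F q = q := by
  have h := (proj_spec hF ⟨q, hq⟩ q).2 q hq
  rw [sub_self, norm_zero, norm_le_zero_iff, sub_eq_zero] at h
  exact h.symm

theorem norm_proj_sub_le (hF : IsCompact F) (hconv : Convex ℝ F) (u : EuclideanSpace ℝ (Fin n))
    {q : EuclideanSpace ℝ (Fin n)} (hq : q ∈ F) : ‖proj F u - q‖ ≤ ‖u - q‖ := by
  simpa only [proj_of_mem hF hq] using norm_proj_sub_proj_le hF hconv ⟨q, hq⟩ u q

theorem measurable_proj (hF : IsCompact F) (hconv : Convex ℝ F) (hne : F.Nonempty) :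
    Measurable (proj F) := by
  have : LipschitzWith 1 (proj F) := LipschitzWith.of_dist_le_mul fun u v => by
    simpa [dist_eq_norm] using norm_proj_sub_proj_le hF hconv hne u v
  exact this.continuous.measurable

end Projection

/-! ### The Gram matrix and the normal equations -/

namespace JumpModel

variable (S : JumpModel K m n) (ystar : EuclideanSpace ℝ (Fin m)) (i : Fin K)

theorem inner_transpose_toEuclideanLin (A : Matrix (Fin m) (Fin n) ℝ)
    (u : EuclideanSpace ℝ (Fin n)) (y : EuclideanSpace ℝ (Fin m)) :
    inner ℝ u (A.transpose.toEuclideanLin y) = inner ℝ (A.toEuclideanLin u) y := by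
  rw [← Matrix.conjTranspose_eq_transpose_of_trivial,
    Matrix.toEuclideanLin_conjTranspose_eq_adjoint, LinearMap.adjoint_inner_right]

theorem toEuclideanLin_mul {l : ℕ} (A : Matrix (Fin m) (Fin n) ℝ) (B : Matrix (Fin n) (Fin l) ℝ)
    (v : EuclideanSpace ℝ (Fin l)) :
    (A * B).toEuclideanLin v = A.toEuclideanLin (B.toEuclideanLin v) := by
  simp [Matrix.toLpLin_apply, Matrix.mulVec_mulVec]

theorem inner_gram (u v : EuclideanSpace ℝ (Fin n)) :
    inner ℝ u ((S.gram i).toEuclideanLin v) =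
      ∑ j, S.P i j * inner ℝ ((S.A j).toEuclideanLin u) ((S.A j).toEuclideanLin v) := by
  simp only [gram, map_sum, map_smul, LinearMap.sum_apply, LinearMap.smul_apply, inner_sum,
    real_inner_smul_right, toEuclideanLin_mul, inner_transpose_toEuclideanLin]

theorem gram_isHermitian : (S.gram i).IsHermitian := by
  rw [Matrix.IsHermitian, Matrix.conjTranspose_eq_transpose_of_trivial, gram,
    Matrix.transpose_sum]
  simp [Matrix.transpose_smul, Matrix.transpose_mul]

variable {S}

theorem toEuclideanLin_injective {A : Matrix (Fin m) (Fin n) ℝ} (hA : A.rank = n) :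
    Function.Injective A.toEuclideanLin := by
  rw [← LinearMap.ker_eq_bot, ← Submodule.finrank_eq_zero (R := ℝ)]
  have h := LinearMap.finrank_range_add_finrank_ker A.toEuclideanLin
  rw [Matrix.rank_eq_finrank_range_toLin A (EuclideanSpace.basisFun (Fin m) ℝ).toBasis
    (EuclideanSpace.basisFun (Fin n) ℝ).toBasis, ← Matrix.toEuclideanLin_eq_toLin_orthonormal] at hA
  rw [hA, finrank_euclideanSpace_fin] at h
  omega

theorem sum_norm_sq_pos (hS : ∀ k, (S.A k).rank = n) {u : EuclideanSpace ℝ (Fin n)}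
    (hu : u ≠ 0) : 0 < ∑ j, S.P i j * ‖(S.A j).toEuclideanLin u‖ ^ 2 := by
  obtain ⟨j, -, hj⟩ : ∃ j ∈ univ, 0 < S.P i j :=
    exists_lt_of_sum_lt (f := fun _ => (0 : ℝ)) (by simp [S.P_sum i])
  refine sum_pos' (fun k _ => mul_nonneg (S.P_nonneg i k) (sq_nonneg _)) ⟨j, mem_univ j, ?_⟩
  have : (S.A j).toEuclideanLin u ≠ 0 := fun h =>
    hu (toEuclideanLin_injective (hS j) (by rw [h, map_zero]))
  positivity

theorem isUnit_gram_det (hS : ∀ k, (S.A k).rank = n) : IsUnit (S.gram i).det := by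
  rw [← Matrix.isUnit_iff_isUnit_det, ← Matrix.mulVec_injective_iff_isUnit]
  refine (injective_iff_map_eq_zero (S.gram i).mulVecLin).2 fun v hv => ?_
  by_contra hne
  have hpos := sum_norm_sq_pos i hS (u := WithLp.toLp 2 v) (by simpa using hne)
  have h := S.inner_gram i (WithLp.toLp 2 v) (WithLp.toLp 2 v)
  have h0 : (S.gram i).toEuclideanLin (WithLp.toLp 2 v) = 0 := by
    rw [Matrix.toLpLin_apply]
    simpa using hv
  simp only [h0, inner_zero_right, real_inner_self_eq_norm_sq] at h
  linarith

theorem gram_optimalInput (hS : ∀ k, (S.A k).rank = n) :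
    (S.gram i).toEuclideanLin (S.optimalInput ystar i) =
      ∑ j, S.P i j • (S.A j).transpose.toEuclideanLin (ystar - S.b j) := by
  rw [optimalInput, ← toEuclideanLin_mul, Matrix.mul_nonsing_inv _ (isUnit_gram_det i hS)]
  simp [Matrix.toLpLin_apply]

/-- The normal equations tested against `u`: averaged against `A_j u`, the residual at `x` may be
replaced by `A_j (x - x*)`. Both the exact two-point gradient formula and the formula for the excess
cost rest on this. -/
theorem sum_inner_meanOutput_sub (hS : ∀ k, (S.A k).rank = n) (u x : EuclideanSpace ℝ (Fin n)) :
    ∑ j, S.P i j * inner ℝ ((S.A j).toEuclideanLin u) (S.meanOutput j x - ystar) =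
      ∑ j, S.P i j * inner ℝ ((S.A j).toEuclideanLin u)
        ((S.A j).toEuclideanLin (x - S.optimalInput ystar i)) := by
  have h1 := congrArg (inner ℝ u) (gram_optimalInput ystar i hS)
  rw [inner_gram] at h1
  simp only [inner_sum, real_inner_smul_right, inner_transpose_toEuclideanLin] at h1
  rw [← sub_eq_zero] at h1 ⊢
  rw [← sum_sub_distrib] at h1 ⊢
  rw [← h1]
  refine sum_congr rfl fun j _ => ?_
  simp only [meanOutput, map_sub, inner_sub_right, inner_add_right]
  ring

theorem norm_sq_le_gram (hS : ∀ k, (S.A k).rank = n) {γ : ℝ} (hγ : 0 < γ)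
    (h : γ ≥ 1 / (8 * lambdaMin (S.gram i))) (u : EuclideanSpace ℝ (Fin n)) :
    ‖u‖ ^ 2 ≤ 8 * γ * ∑ j, S.P i j * ‖(S.A j).toEuclideanLin u‖ ^ 2 := by
  -- For `n = 0` the spectrum is empty and `lambdaMin` is the default `sInf ∅ = 0`, but then every
  -- vector is zero.
  rcases Nat.eq_zero_or_pos n with rfl | hn
  · rw [Subsingleton.elim u 0]
    simp
  have : Nonempty (Fin n) := ⟨⟨0, hn⟩⟩
  set G := S.gram i with hG
  have hherm : G.IsHermitian := S.gram_isHermitian i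
  let e := hherm.eigenvectorBasis
  have hlin : ∀ q, G.toEuclideanLin (e q) = hherm.eigenvalues q • e q := fun q => by
    rw [Matrix.toLpLin_apply, hherm.mulVec_eigenvectorBasis]
    rfl
  have hquad : ∀ v, inner ℝ v (G.toEuclideanLin v) =
      ∑ j, S.P i j * ‖(S.A j).toEuclideanLin v‖ ^ 2 := fun v => by
    simp only [hG, inner_gram, real_inner_self_eq_norm_sq]
  have hsymm : ∀ v w, inner ℝ v (G.toEuclideanLin w) = inner ℝ (G.toEuclideanLin v) w :=
    fun v w => by
      rw [real_inner_comm _ (G.toEuclideanLin v), hG, inner_gram, inner_gram]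
      simp only [real_inner_comm]
  have hpos : ∀ q, 0 < hherm.eigenvalues q := fun q => by
    have h1 := sum_norm_sq_pos i hS (u := e q) (by
      intro h0
      have := e.norm_eq_one q
      rw [h0, norm_zero] at this
      exact zero_ne_one this)
    rwa [← hquad, hlin, real_inner_smul_right, real_inner_self_eq_norm_sq, e.norm_eq_one,
      one_pow, mul_one] at h1
  have hspec : spectrum ℝ G = Set.range hherm.eigenvalues :=
    hherm.spectrum_real_eq_range_eigenvalues
  have hfin : (spectrum ℝ G).Finite := hspec ▸ Set.finite_range _
  have hne : (spectrum ℝ G).Nonempty := hspec ▸ Set.range_nonempty _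
  -- Full column rank is what gives the hypothesis on `γ` content: if `lambdaMin` were `0`, the
  -- convention `1 / 0 = 0` would empty it.
  have hlam : 0 < lambdaMin G := by
    have hm : lambdaMin G ∈ spectrum ℝ G := hne.csInf_mem hfin
    rw [hspec] at hm
    obtain ⟨q, hq⟩ := hm
    exact hq ▸ hpos q
  have hle : ∀ q, lambdaMin G ≤ hherm.eigenvalues q := fun q =>
    csInf_le hfin.bddBelow (hspec ▸ Set.mem_range_self q)
  have hlow : lambdaMin G * ‖u‖ ^ 2 ≤ inner ℝ u (G.toEuclideanLin u) := by
    rw [← e.sum_sq_norm_inner_right u, ← e.sum_inner_mul_inner, mul_sum]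
    refine sum_le_sum fun q _ => ?_
    rw [hsymm, hlin, real_inner_smul_left, real_inner_comm u (e q), Real.norm_eq_abs, sq_abs]
    nlinarith [hle q, sq_nonneg (inner ℝ (e q) u)]
  have hγ8 : 1 ≤ 8 * γ * lambdaMin G := by
    rw [ge_iff_le, div_le_iff₀ (by positivity)] at h
    linarith
  rw [← hquad]
  calc ‖u‖ ^ 2 ≤ (8 * γ * lambdaMin G) * ‖u‖ ^ 2 := le_mul_of_one_le_left (sq_nonneg _) hγ8
    _ = 8 * γ * (lambdaMin G * ‖u‖ ^ 2) := by ring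
    _ ≤ _ := by gcongr

end JumpModel

/-! ### Second and fourth moments of a shifted noise vector -/

section Noise

variable {f : Measure (EuclideanSpace ℝ (Fin m))}

theorem integrable_norm_sq (h2 : ∀ l, Integrable (fun w => w l ^ 2) f) :
    Integrable (fun w => ‖w‖ ^ 2) f := by
  simp only [EuclideanSpace.real_norm_sq_eq]
  exact integrable_finsetSum _ fun l _ => h2 l

theorem integral_inner_eq_zero (h1 : ∀ l, Integrable (fun w => w l) f)
    (h0 : ∀ l, ∫ w, w l ∂f = 0) (v : EuclideanSpace ℝ (Fin m)) :
    Integrable (fun w => inner ℝ v w) f ∧ ∫ w, inner ℝ v w ∂f = 0 := by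
  simp only [PiLp.inner_apply, RCLike.inner_apply, conj_trivial]
  refine ⟨integrable_finsetSum _ fun l _ => (h1 l).mul_const _, ?_⟩
  rw [integral_finsetSum _ fun l _ => (h1 l).mul_const _]
  simp [integral_mul_const, h0]

variable [IsProbabilityMeasure f]

theorem integrable_norm_add_sq (h1 : ∀ l, Integrable (fun w => w l) f)
    (h0 : ∀ l, ∫ w, w l ∂f = 0) (h2 : ∀ l, Integrable (fun w => w l ^ 2) f)
    (v : EuclideanSpace ℝ (Fin m)) : Integrable (fun w => ‖v + w‖ ^ 2) f := by
  simp only [norm_add_sq_real]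
  exact ((integrable_const _).add ((integral_inner_eq_zero h1 h0 v).1.const_mul 2)).add
    (integrable_norm_sq h2)

theorem integral_norm_add_sq (h1 : ∀ l, Integrable (fun w => w l) f)
    (h0 : ∀ l, ∫ w, w l ∂f = 0) (h2 : ∀ l, Integrable (fun w => w l ^ 2) f)
    (v : EuclideanSpace ℝ (Fin m)) :
    ∫ w, ‖v + w‖ ^ 2 ∂f = ‖v‖ ^ 2 + ∫ w, ‖w‖ ^ 2 ∂f := by
  have hi := integral_inner_eq_zero h1 h0 v
  simp only [norm_add_sq_real]
  have h1' := integral_add ((integrable_const (‖v‖ ^ 2)).add (hi.1.const_mul 2))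
    (integrable_norm_sq h2)
  simp only [Pi.add_apply] at h1'
  rw [h1', integral_add (integrable_const _) (hi.1.const_mul 2), integral_const_mul, hi.2]
  simp

/-- Two uses of `(a + b)² ≤ 2a² + 2b²`, then Cauchy–Schwarz over the `m` coordinates, since only
entrywise fourth moments are controlled. -/
theorem norm_add_pow_four_le (v w : EuclideanSpace ℝ (Fin m)) :
    (‖v + w‖ ^ 2) ^ 2 ≤ 8 * ‖v‖ ^ 4 + 8 * m * ∑ l, w l ^ 4 := by
  have h1 : ‖v + w‖ ^ 2 ≤ 2 * ‖v‖ ^ 2 + 2 * ‖w‖ ^ 2 := by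
    have := pow_le_pow_left₀ (norm_nonneg _) (norm_add_le v w) 2
    nlinarith [sq_nonneg (‖v‖ - ‖w‖)]
  have h2 : (‖w‖ ^ 2) ^ 2 ≤ m * ∑ l, w l ^ 4 := by
    rw [EuclideanSpace.real_norm_sq_eq]
    refine (sq_sum_le_card_mul_sum_sq).trans_eq ?_
    simp [← pow_mul]
  have h3 := pow_le_pow_left₀ (sq_nonneg _) h1 2
  nlinarith [sq_nonneg (‖v‖ ^ 2 - ‖w‖ ^ 2)]

theorem integrable_norm_add_pow_four (h4 : ∀ l, Integrable (fun w => w l ^ 4) f)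
    (v : EuclideanSpace ℝ (Fin m)) : Integrable (fun w => (‖v + w‖ ^ 2) ^ 2) f := by
  refine Integrable.mono' (g := fun w => 8 * ‖v‖ ^ 4 + 8 * m * ∑ l, w l ^ 4)
    ((integrable_const _).add ((integrable_finsetSum _ fun l _ => h4 l).const_mul _))
    (by fun_prop) (Filter.Eventually.of_forall fun w => ?_)
  rw [Real.norm_of_nonneg (sq_nonneg _)]
  exact norm_add_pow_four_le v w

theorem integral_norm_add_pow_four_le (h4 : ∀ l, Integrable (fun w => w l ^ 4) f) {σ : ℝ}
    (hσ : ∀ l, ∫ w, w l ^ 4 ∂f ≤ σ ^ 4) (v : EuclideanSpace ℝ (Fin m)) :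
    ∫ w, (‖v + w‖ ^ 2) ^ 2 ∂f ≤ 8 * ‖v‖ ^ 4 + 8 * m ^ 2 * σ ^ 4 := by
  have hs : Integrable (fun w : EuclideanSpace ℝ (Fin m) => ∑ l, w l ^ 4) f :=
    integrable_finsetSum _ fun l _ => h4 l
  refine (integral_mono (integrable_norm_add_pow_four h4 v)
    ((integrable_const _).add (hs.const_mul (8 * (m : ℝ))))
    fun w => norm_add_pow_four_le v w).trans ?_
  simp only [Pi.add_apply]
  rw [integral_add (integrable_const _) (hs.const_mul _), integral_const_mul (8 * (m : ℝ)),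
    integral_finsetSum _ fun l _ => h4 l]
  have : ∑ l, ∫ w, w l ^ 4 ∂f ≤ m * σ ^ 4 := by
    simpa using sum_le_card_nsmul univ (fun l => ∫ w, w l ^ 4 ∂f) _ fun l _ => hσ l
  have h8 : (0 : ℝ) ≤ 8 * m := by positivity
  have := mul_le_mul_of_nonneg_left this h8
  simp only [integral_const, probReal_univ, smul_eq_mul, one_mul]
  linarith

end Noise

/-! ### The observed cost at a fixed input -/

section Outcome

variable (S : JumpModel K m n) (ystar : EuclideanSpace ℝ (Fin m)) (i : Fin K)

/-- The conditional distribution of `(s_t, w_t)` given the past with `s_{t-1} = i`. -/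
def outcomeLaw : Measure (Fin K × EuclideanSpace ℝ (Fin m)) :=
  ∑ j, ENNReal.ofReal (S.P i j) • (S.f j).map (Prod.mk j)

theorem sum_ofReal_P : ∑ j, ENNReal.ofReal (S.P i j) = 1 := by
  rw [← ENNReal.ofReal_sum_of_nonneg fun j _ => S.P_nonneg i j, S.P_sum, ENNReal.ofReal_one]

instance : IsProbabilityMeasure (outcomeLaw S i) := by
  have := S.f_prob
  have (j : Fin K) : IsProbabilityMeasure ((S.f j).map (Prod.mk j)) :=
    Measure.isProbabilityMeasure_map (by fun_prop)
  constructor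
  simp only [outcomeLaw, Measure.coe_finsetSum, Finset.sum_apply, Measure.smul_apply,
    measure_univ, smul_eq_mul, mul_one, sum_ofReal_P]

variable {S}

theorem integrable_outcomeLaw {φ : Fin K × EuclideanSpace ℝ (Fin m) → ℝ} (hφ : Measurable φ)
    (h : ∀ j, Integrable (fun w => φ (j, w)) (S.f j)) : Integrable φ (outcomeLaw S i) := by
  refine integrable_finsetSum_measure.2 fun j _ =>
    Integrable.smul_measure ?_ ENNReal.ofReal_ne_top
  exact (integrable_map_measure hφ.aestronglyMeasurable (by fun_prop)).2 (h j)

theorem integral_outcomeLaw {φ : Fin K × EuclideanSpace ℝ (Fin m) → ℝ} (hφ : Measurable φ)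
    (h : ∀ j, Integrable (fun w => φ (j, w)) (S.f j)) :
    ∫ o, φ o ∂(outcomeLaw S i) = ∑ j, S.P i j * ∫ w, φ (j, w) ∂(S.f j) := by
  rw [outcomeLaw, integral_finsetSum_measure fun j _ => Integrable.smul_measure
    ((integrable_map_measure hφ.aestronglyMeasurable (by fun_prop)).2 (h j))
    ENNReal.ofReal_ne_top]
  refine sum_congr rfl fun j _ => ?_
  rw [integral_smul_measure, ENNReal.toReal_ofReal (S.P_nonneg i j),
    integral_map (by fun_prop) hφ.aestronglyMeasurable, smul_eq_mul]

/-- The perturbation is placed in the outer integral because the gradient estimate is analysed at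
fixed `δ` first and averaged over `δ` last. -/
theorem lintegral_stageLaw {F : Set (EuclideanSpace ℝ (Fin n))} (D : Design K F)
    {φ : Stage K m n → ENNReal} (hφ : Measurable φ) :
    ∫⁻ ξ, φ ξ ∂(stageLaw S D i) = ∫⁻ δ, ∫⁻ o, φ (o.1, o.2, δ) ∂(outcomeLaw S i)
      ∂(Measure.pi fun _ : Fin n => D.ν) := by
  have := S.f_prob
  have := D.ν_prob
  have hm : Measurable fun p : (Fin n → ℝ) × Fin K × EuclideanSpace ℝ (Fin m) =>
      φ (p.2.1, p.2.2, p.1) := hφ.comp (by fun_prop)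
  have hj (j : Fin K) : Measurable fun p : (Fin n → ℝ) × EuclideanSpace ℝ (Fin m) =>
      φ (j, p.2, p.1) := hφ.comp (by fun_prop)
  have hin (δ : Fin n → ℝ) : ∫⁻ o, φ (o.1, o.2, δ) ∂(outcomeLaw S i) =
      ∑ j, ENNReal.ofReal (S.P i j) * ∫⁻ w, φ (j, w, δ) ∂(S.f j) := by
    rw [outcomeLaw, lintegral_finsetSum_measure]
    refine sum_congr rfl fun j _ => ?_
    rw [lintegral_smul_measure, lintegral_map (by fun_prop) (by fun_prop), smul_eq_mul]
  simp only [hin]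
  rw [lintegral_finsetSum _ fun j _ => (hj j).lintegral_prod_right'.const_mul _, stageLaw,
    lintegral_finsetSum_measure]
  refine sum_congr rfl fun j _ => ?_
  rw [lintegral_smul_measure, Measure.dirac_prod, lintegral_map hφ (by fun_prop),
    lintegral_prod_symm _ (by fun_prop),
    lintegral_const_mul _ (hj j).lintegral_prod_right', smul_eq_mul]

variable (S)

/-- The observed cost `‖y_t - y*‖²` at input `x`, as a function of `(s_t, w_t)`. -/
def outcomeCost (x : EuclideanSpace ℝ (Fin n)) (o : Fin K × EuclideanSpace ℝ (Fin m)) : ℝ :=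
  ‖S.meanOutput o.1 x + o.2 - ystar‖ ^ 2

theorem outcomeCost_mk (x : EuclideanSpace ℝ (Fin n)) (j : Fin K)
    (w : EuclideanSpace ℝ (Fin m)) :
    outcomeCost S ystar x (j, w) = ‖(S.meanOutput j x - ystar) + w‖ ^ 2 := by
  rw [outcomeCost, sub_add_eq_add_sub]

theorem measurable_meanOutput :
    Measurable fun p : Fin K × EuclideanSpace ℝ (Fin n) => S.meanOutput p.1 p.2 := by
  refine measurable_from_prod_countable_right fun j => ?_
  have : Continuous (S.A j).toEuclideanLin := LinearMap.continuous_of_finiteDimensional _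
  exact (this.measurable.add_const (S.b j) :)

theorem measurable_outcomeCost (x : EuclideanSpace ℝ (Fin n)) :
    Measurable (outcomeCost S ystar x) := by
  refine measurable_from_prod_countable_right fun j => ?_
  simp only [outcomeCost]
  fun_prop

variable {S ystar}
variable {F : Set (EuclideanSpace ℝ (Fin n))}
  {Θ : Set (Fin K → Matrix (Fin m) (Fin n) ℝ × EuclideanSpace ℝ (Fin m))} {σ : ℝ}

theorem integrable_outcomeCost (hS : Admissible ystar F Θ σ S) (x : EuclideanSpace ℝ (Fin n)) :
    Integrable (outcomeCost S ystar x) (outcomeLaw S i) := by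
  have := S.f_prob
  refine integrable_outcomeLaw i (measurable_outcomeCost S ystar x) fun j => ?_
  simp only [outcomeCost_mk]
  exact integrable_norm_add_sq (hS.integrable j) (hS.mean_zero j) (hS.integrable_sq j) _

theorem integral_outcomeCost (hS : Admissible ystar F Θ σ S) (x : EuclideanSpace ℝ (Fin n)) :
    ∫ o, outcomeCost S ystar x o ∂(outcomeLaw S i) =
      ∑ j, S.P i j * (‖S.meanOutput j x - ystar‖ ^ 2 + ∫ w, ‖w‖ ^ 2 ∂(S.f j)) := by
  have := S.f_prob
  rw [integral_outcomeLaw i (measurable_outcomeCost S ystar x)]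
  · simp only [outcomeCost_mk]
    refine sum_congr rfl fun j _ => ?_
    rw [integral_norm_add_sq (hS.integrable j) (hS.mean_zero j) (hS.integrable_sq j)]
  · intro j
    simp only [outcomeCost_mk]
    exact integrable_norm_add_sq (hS.integrable j) (hS.mean_zero j) (hS.integrable_sq j) _

theorem stageCost_eq (hS : Admissible ystar F Θ σ S) (x : EuclideanSpace ℝ (Fin n)) :
    S.stageCost ystar i x =
      ∑ j, S.P i j * (‖S.meanOutput j x - ystar‖ ^ 2 + ∫ w, ‖w‖ ^ 2 ∂(S.f j)) := by
  have := S.f_prob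
  refine sum_congr rfl fun j _ => ?_
  rw [← integral_norm_add_sq (hS.integrable j) (hS.mean_zero j) (hS.integrable_sq j)]
  simp only [norm_sub_rev ystar, sub_add_eq_add_sub]

theorem integrable_outcomeCost_sq (hS : Admissible ystar F Θ σ S)
    (x : EuclideanSpace ℝ (Fin n)) :
    Integrable (fun o => outcomeCost S ystar x o ^ 2) (outcomeLaw S i) := by
  have := S.f_prob
  refine integrable_outcomeLaw i ((measurable_outcomeCost S ystar x).pow_const 2) fun j => ?_
  simp only [outcomeCost_mk]
  exact integrable_norm_add_pow_four (hS.integrable_four j) _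

theorem integral_outcomeCost_sq_le (hS : Admissible ystar F Θ σ S)
    {x : EuclideanSpace ℝ (Fin n)} {B : ℝ} (hB : ∀ j, ‖S.meanOutput j x - ystar‖ ≤ B) :
    ∫ o, outcomeCost S ystar x o ^ 2 ∂(outcomeLaw S i) ≤ 8 * B ^ 4 + 8 * m ^ 2 * σ ^ 4 := by
  have := S.f_prob
  rw [integral_outcomeLaw i ((measurable_outcomeCost S ystar x).pow_const 2)]
  · calc _ ≤ ∑ j, S.P i j * (8 * B ^ 4 + 8 * m ^ 2 * σ ^ 4) := by
          refine sum_le_sum fun j _ => mul_le_mul_of_nonneg_left ?_ (S.P_nonneg i j)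
          simp only [outcomeCost_mk]
          refine (integral_norm_add_pow_four_le (hS.integrable_four j)
            (hS.moment_four j) _).trans ?_
          have := pow_le_pow_left₀ (norm_nonneg _) (hB j) 4
          linarith
      _ = _ := by rw [← sum_mul, S.P_sum, one_mul]
  · intro j
    simp only [outcomeCost_mk]
    exact integrable_norm_add_pow_four (hS.integrable_four j) _

theorem meanOutput_add (x v : EuclideanSpace ℝ (Fin n)) (j : Fin K) :
    S.meanOutput j (x + v) - ystar = (S.meanOutput j x - ystar) + (S.A j).toEuclideanLin v := by
  simp only [JumpModel.meanOutput, map_add]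
  abel

/-- Terms even in `v`, including the noise variance, cancel in the symmetric difference of a
quadratic. The two-point gradient estimate is therefore unbiased for every gain, with no Taylor
remainder. -/
theorem integral_outcomeCost_add_sub (hS : Admissible ystar F Θ σ S)
    (x v : EuclideanSpace ℝ (Fin n)) :
    ∫ o, outcomeCost S ystar (x + v) o ∂(outcomeLaw S i) -
      ∫ o, outcomeCost S ystar (x - v) o ∂(outcomeLaw S i) =
    4 * inner ℝ v ((S.gram i).toEuclideanLin (x - S.optimalInput ystar i)) := by
  rw [integral_outcomeCost i hS, integral_outcomeCost i hS, S.inner_gram,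
    ← JumpModel.sum_inner_meanOutput_sub ystar i hS.rank_eq, mul_sum, ← sum_sub_distrib]
  refine sum_congr rfl fun j _ => ?_
  rw [sub_eq_add_neg x v, meanOutput_add, meanOutput_add, map_neg, ← sub_eq_add_neg,
    norm_add_sq_real, norm_sub_sq_real (S.meanOutput j x - ystar),
    real_inner_comm _ (S.meanOutput j x - ystar)]
  ring

/-- The linear term in the expansion around the optimum vanishes by the normal equations. -/
theorem stageCost_sub_optimal (hS : Admissible ystar F Θ σ S) (x : EuclideanSpace ℝ (Fin n)) :
    S.stageCost ystar i x - S.stageCost ystar i (S.optimalInput ystar i) =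
      ∑ j, S.P i j * ‖(S.A j).toEuclideanLin (x - S.optimalInput ystar i)‖ ^ 2 := by
  have h := JumpModel.sum_inner_meanOutput_sub ystar i hS.rank_eq
    (x - S.optimalInput ystar i) (S.optimalInput ystar i)
  rw [sub_self] at h
  simp only [map_zero, inner_zero_right, mul_zero, sum_const_zero] at h
  rw [stageCost_eq i hS, stageCost_eq i hS, ← sum_sub_distrib, ← add_zero (∑ j, _ * ‖_‖ ^ 2),
    ← mul_zero 2, ← h, mul_sum, ← sum_add_distrib]
  refine sum_congr rfl fun j _ => ?_
  have hx : S.meanOutput j x - ystar = (S.meanOutput j (S.optimalInput ystar i) - ystar) +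
      (S.A j).toEuclideanLin (x - S.optimalInput ystar i) := by
    rw [← meanOutput_add, add_sub_cancel]
  rw [hx, norm_add_sq_real, real_inner_comm]
  ring

end Outcome

/-! ### Moments of the perturbations and their reciprocals -/

section Perturbation

variable {ν : Measure ℝ} {ξ₁ ξ₂ : ℝ}

theorem ae_ne_zero_of_lintegral_inv_sq
    (h : ∫⁻ x, (ENNReal.ofReal (x ^ 2))⁻¹ ∂ν ≤ ENNReal.ofReal ξ₂) : ∀ᵐ x ∂ν, x ≠ 0 := by
  filter_upwards [ae_lt_top (by fun_prop) (h.trans_lt ENNReal.ofReal_lt_top).ne] with x hx h0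
  simp [h0] at hx

theorem integrable_inv_sq (h : ∫⁻ x, (ENNReal.ofReal (x ^ 2))⁻¹ ∂ν ≤ ENNReal.ofReal ξ₂)
    (hξ₂ : 0 ≤ ξ₂) :
    Integrable (fun x : ℝ => (1 / x) ^ 2) ν ∧ ∫ x, (1 / x) ^ 2 ∂ν ≤ ξ₂ := by
  have hle : ∫⁻ x, ENNReal.ofReal ((1 / x) ^ 2) ∂ν ≤ ENNReal.ofReal ξ₂ := by
    refine (lintegral_mono fun x => ?_).trans h
    rcases eq_or_ne x 0 with rfl | hx
    · simp
    · rw [← ENNReal.ofReal_inv_of_pos (by positivity), one_div, inv_pow]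
  have hint : Integrable (fun x : ℝ => (1 / x) ^ 2) ν := by
    refine ⟨Measurable.aestronglyMeasurable (by fun_prop), ?_⟩
    rw [hasFiniteIntegral_iff_ofReal (Filter.Eventually.of_forall fun x => sq_nonneg _)]
    exact hle.trans_lt ENNReal.ofReal_lt_top
  refine ⟨hint, (ENNReal.ofReal_le_ofReal_iff hξ₂).1 ?_⟩
  rwa [ofReal_integral_eq_lintegral_ofReal hint (Filter.Eventually.of_forall fun x => sq_nonneg _)]

theorem integral_id_eq_zero_of_symm (hs : ν.map (fun x => -x) = ν) : ∫ x, x ∂ν = 0 := by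
  have h : ∫ x, x ∂ν = ∫ x, -x ∂ν := by
    conv_lhs => rw [← hs]
    exact integral_map (by fun_prop) (by fun_prop)
  rw [integral_neg] at h
  linarith

variable [IsProbabilityMeasure ν]

theorem integrable_id_of_bound (hb : ∀ᵐ x ∂ν, |x| ≤ ξ₁) : Integrable (fun x : ℝ => x) ν :=
  Integrable.of_bound (by fun_prop) ξ₁ hb

theorem integrable_inv (h : ∫⁻ x, (ENNReal.ofReal (x ^ 2))⁻¹ ∂ν ≤ ENNReal.ofReal ξ₂)
    (hξ₂ : 0 ≤ ξ₂) : Integrable (fun x : ℝ => 1 / x) ν := by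
  refine Integrable.mono' ((integrable_const (1 : ℝ)).add (integrable_inv_sq h hξ₂).1)
    (Measurable.aestronglyMeasurable (by fun_prop)) (Filter.Eventually.of_forall fun x => ?_)
  simp only [Pi.add_apply, Real.norm_eq_abs]
  rw [← sq_abs (1 / x)]
  nlinarith [sq_nonneg (|1 / x| - 1), abs_nonneg (1 / x)]

variable (n) in
-- On the diagonal the product is one almost surely, as the inverse second moment excludes an atom
-- at zero. Off the diagonal, independence leaves the factor `𝔼 δ_l = 0`; this is the only use of
-- symmetry.
theorem integral_coord_mul_inv (hb : ∀ᵐ x ∂ν, |x| ≤ ξ₁) (hs : ν.map (fun x => -x) = ν)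
    (h : ∫⁻ x, (ENNReal.ofReal (x ^ 2))⁻¹ ∂ν ≤ ENNReal.ofReal ξ₂) (hξ₂ : 0 ≤ ξ₂) (l q : Fin n) :
    Integrable (fun δ : Fin n → ℝ => δ l * (1 / δ q)) (Measure.pi fun _ => ν) ∧
      ∫ δ : Fin n → ℝ, δ l * (1 / δ q) ∂(Measure.pi fun _ => ν) = if l = q then 1 else 0 := by
  have hev (l : Fin n) : MeasurePreserving (Function.eval l) (Measure.pi fun _ : Fin n => ν) ν :=
    measurePreserving_eval (fun _ => ν) l
  rcases eq_or_ne l q with rfl | hne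
  · have h1 : (fun δ : Fin n → ℝ => δ l * (1 / δ l)) =ᵐ[Measure.pi fun _ => ν] fun _ => 1 := by
      filter_upwards [(hev l).quasiMeasurePreserving.ae (ae_ne_zero_of_lintegral_inv_sq h)]
        with δ hδ
      exact mul_one_div_cancel hδ
    exact ⟨(integrable_const _).congr h1.symm, by rw [integral_congr_ae h1]; simp⟩
  · have hind : IndepFun (fun δ : Fin n → ℝ => δ l) (fun δ => 1 / δ q)
        (Measure.pi fun _ => ν) := by
      have := (iIndepFun_pi (ι := Fin n) (μ := fun _ => ν) (X := fun _ x => x)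
        fun _ => aemeasurable_id).indepFun hne
      exact this.comp measurable_id (ψ := fun x : ℝ => 1 / x) (by fun_prop)
    have hl : Integrable (fun δ : Fin n → ℝ => δ l) (Measure.pi fun _ => ν) :=
      (hev l).integrable_comp_of_integrable (integrable_id_of_bound hb)
    have hq : Integrable (fun δ : Fin n → ℝ => 1 / δ q) (Measure.pi fun _ => ν) :=
      (hev q).integrable_comp_of_integrable (integrable_inv h hξ₂)
    refine ⟨hind.integrable_mul hl hq, ?_⟩
    have h0 : ∫ δ : Fin n → ℝ, δ l ∂(Measure.pi fun _ => ν) = 0 := by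
      rw [← integral_id_eq_zero_of_symm hs]
      conv_rhs => rw [← (hev l).map_eq]
      rw [integral_map (hev l).aemeasurable (by fun_prop)]
    rw [hind.integral_fun_mul_eq_mul_integral hl.1 hq.1, h0, zero_mul, if_neg hne]

theorem integral_inner_mul_inner_inv (hb : ∀ᵐ x ∂ν, |x| ≤ ξ₁) (hs : ν.map (fun x => -x) = ν)
    (h : ∫⁻ x, (ENNReal.ofReal (x ^ 2))⁻¹ ∂ν ≤ ENNReal.ofReal ξ₂) (hξ₂ : 0 ≤ ξ₂)
    (v u : EuclideanSpace ℝ (Fin n)) :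
    Integrable (fun δ : Fin n → ℝ => inner ℝ (WithLp.toLp 2 δ) v *
        inner ℝ u (WithLp.toLp 2 fun l => 1 / δ l)) (Measure.pi fun _ => ν) ∧
      ∫ δ : Fin n → ℝ, inner ℝ (WithLp.toLp 2 δ) v *
        inner ℝ u (WithLp.toLp 2 fun l => 1 / δ l) ∂(Measure.pi fun _ => ν) = inner ℝ u v := by
  have hexp (δ : Fin n → ℝ) : inner ℝ (WithLp.toLp 2 δ) v *
      inner ℝ u (WithLp.toLp 2 fun l => 1 / δ l) =
      ∑ l, ∑ q, v l * u q * (δ l * (1 / δ q)) := by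
    simp only [PiLp.inner_apply, RCLike.inner_apply, conj_trivial, sum_mul_sum]
    exact sum_congr rfl fun l _ => sum_congr rfl fun q _ => by ring
  have hint (l q : Fin n) := (integral_coord_mul_inv n hb hs h hξ₂ l q)
  simp only [hexp]
  refine ⟨integrable_finsetSum _ fun l _ => integrable_finsetSum _ fun q _ =>
    (hint l q).1.const_mul _, ?_⟩
  rw [integral_finsetSum _ fun l _ => integrable_finsetSum _ fun q _ => (hint l q).1.const_mul _]
  simp only [integral_finsetSum _ fun q _ => (hint _ q).1.const_mul _, integral_const_mul,
    (hint _ _).2]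
  simp [PiLp.inner_apply]

theorem integral_norm_inv_sq_le (h : ∫⁻ x, (ENNReal.ofReal (x ^ 2))⁻¹ ∂ν ≤ ENNReal.ofReal ξ₂)
    (hξ₂ : 0 ≤ ξ₂) :
    Integrable (fun δ : Fin n → ℝ => ‖(WithLp.toLp 2 fun l => 1 / δ l :
      EuclideanSpace ℝ (Fin n))‖ ^ 2) (Measure.pi fun _ => ν) ∧
      ∫ δ : Fin n → ℝ, ‖(WithLp.toLp 2 fun l => 1 / δ l : EuclideanSpace ℝ (Fin n))‖ ^ 2
        ∂(Measure.pi fun _ => ν) ≤ n * ξ₂ := by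
  have hev (l : Fin n) : MeasurePreserving (Function.eval l) (Measure.pi fun _ : Fin n => ν) ν :=
    measurePreserving_eval (fun _ => ν) l
  have hint (l : Fin n) : Integrable (fun δ : Fin n → ℝ => (1 / δ l) ^ 2)
      (Measure.pi fun _ => ν) :=
    (hev l).integrable_comp_of_integrable (integrable_inv_sq h hξ₂).1
  simp only [EuclideanSpace.real_norm_sq_eq]
  refine ⟨integrable_finsetSum _ fun l _ => hint l, ?_⟩
  rw [integral_finsetSum _ fun l _ => hint l]
  have hle (l : Fin n) : ∫ δ : Fin n → ℝ, (1 / δ l) ^ 2 ∂(Measure.pi fun _ => ν) ≤ ξ₂ := by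
    refine le_trans (le_of_eq ?_) (integrable_inv_sq h hξ₂).2
    conv_rhs => rw [← (hev l).map_eq]
    rw [integral_map (hev l).aemeasurable (Measurable.aestronglyMeasurable (by fun_prop))]
  simpa using sum_le_card_nsmul univ _ _ fun l _ => hle l

theorem ae_norm_sq_le (hb : ∀ᵐ x ∂ν, |x| ≤ ξ₁) :
    ∀ᵐ δ : Fin n → ℝ ∂(Measure.pi fun _ => ν),
      ‖(WithLp.toLp 2 δ : EuclideanSpace ℝ (Fin n))‖ ^ 2 ≤ n * ξ₁ ^ 2 := by
  have : ∀ᵐ δ : Fin n → ℝ ∂(Measure.pi fun _ => ν), ∀ l, |δ l| ≤ ξ₁ :=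
    ae_all_iff.2 fun l =>
      (measurePreserving_eval (fun _ => ν) l).quasiMeasurePreserving.ae hb
  filter_upwards [this] with δ hδ
  rw [EuclideanSpace.real_norm_sq_eq]
  simpa using sum_le_card_nsmul univ (fun l => δ l ^ 2) (ξ₁ ^ 2) fun l _ => by
    rw [← sq_abs]
    exact pow_le_pow_left₀ (abs_nonneg _) (hδ l) 2

end Perturbation

/-! ### Measurability of the policy -/

section MemoryMeasurable

namespace Memory

/-- The components of a memory as a tuple. -/
def toProd (M : Memory n) : ℕ × Bool × EuclideanSpace ℝ (Fin n) × (Fin n → ℝ) × ℝ :=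
  (M.count, M.flag, M.est, M.pert, M.dPlus)

instance : MeasurableSpace (Memory n) := MeasurableSpace.comap toProd inferInstance

theorem measurable_toProd : Measurable (toProd : Memory n → _) := comap_measurable _

theorem measurable_count : Measurable (count : Memory n → ℕ) :=
  measurable_fst.comp measurable_toProd

theorem measurable_flag : Measurable (flag : Memory n → Bool) :=
  (measurable_fst.comp measurable_snd).comp measurable_toProd

theorem measurable_est : Measurable (est : Memory n → EuclideanSpace ℝ (Fin n)) :=
  (measurable_fst.comp (measurable_snd.comp measurable_snd)).comp measurable_toProd

theorem measurable_pert : Measurable (pert : Memory n → Fin n → ℝ) :=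
  (measurable_fst.comp (measurable_snd.comp (measurable_snd.comp measurable_snd))).comp
    measurable_toProd

theorem measurable_dPlus : Measurable (dPlus : Memory n → ℝ) :=
  (measurable_snd.comp (measurable_snd.comp (measurable_snd.comp measurable_snd))).comp
    measurable_toProd

theorem measurable_mk {α : Type*} [MeasurableSpace α] {c : α → ℕ} {f : α → Bool}
    {e : α → EuclideanSpace ℝ (Fin n)} {p : α → Fin n → ℝ} {d : α → ℝ} (hc : Measurable c)
    (hf : Measurable f) (he : Measurable e) (hp : Measurable p) (hd : Measurable d) :
    Measurable fun x => (⟨c x, f x, e x, p x, d x⟩ : Memory n) :=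
  measurable_comap_iff.2 (hc.prodMk (hf.prodMk (he.prodMk (hp.prodMk hd))))

end Memory

variable {F : Set (EuclideanSpace ℝ (Fin n))} (D : Design K F) (i : Fin K)

theorem Design.measurable_input :
    Measurable fun p : Memory n × (Fin n → ℝ) => D.input i p.1 p.2 := by
  have hg : Measurable (D.gain i) := measurable_of_countable _
  have hc : Measurable fun p : Memory n × (Fin n → ℝ) => p.1.count :=
    Memory.measurable_count.comp measurable_fst
  have he : Measurable fun p : Memory n × (Fin n → ℝ) => p.1.est :=
    Memory.measurable_est.comp measurable_fst
  have hp : Measurable fun p : Memory n × (Fin n → ℝ) => p.1.pert :=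
    Memory.measurable_pert.comp measurable_fst
  have hf : Measurable fun p : Memory n × (Fin n → ℝ) => p.1.flag :=
    Memory.measurable_flag.comp measurable_fst
  refine Measurable.ite (hf (measurableSet_singleton false)) ?_ ?_
  · exact he.add ((hg.comp (hc.add_const 1)).smul
      ((WithLp.measurable_toLp 2 (Fin n → ℝ)).comp measurable_snd))
  · exact he.sub ((hg.comp hc).smul ((WithLp.measurable_toLp 2 (Fin n → ℝ)).comp hp))

theorem Design.measurable_update (hF : IsCompact F) (hconv : Convex ℝ F)
    (ystar : EuclideanSpace ℝ (Fin m)) :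
    Measurable fun p : Memory n × (Fin n → ℝ) × EuclideanSpace ℝ (Fin m) =>
      D.update ystar i p.1 p.2.1 p.2.2 := by
  have hg : Measurable (D.gain i) := measurable_of_countable _
  have ha : Measurable (D.stepSize i) := measurable_of_countable _
  let β := (Fin n → ℝ) × EuclideanSpace ℝ (Fin m)
  have hc : Measurable fun p : Memory n × β => p.1.count :=
    Memory.measurable_count.comp measurable_fst
  have he : Measurable fun p : Memory n × β => p.1.est :=
    Memory.measurable_est.comp measurable_fst
  have hp : Measurable fun p : Memory n × β => p.1.pert :=
    Memory.measurable_pert.comp measurable_fst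
  have hf : Measurable fun p : Memory n × β => p.1.flag :=
    Memory.measurable_flag.comp measurable_fst
  have hd : Measurable fun p : Memory n × β => p.1.dPlus :=
    Memory.measurable_dPlus.comp measurable_fst
  have hy : Measurable fun p : Memory n × β => ‖p.2.2 - ystar‖ ^ 2 :=
    ((measurable_snd.comp measurable_snd).sub_const ystar).norm.pow_const 2
  have hinv : Measurable fun p : Memory n × β => fun l => 1 / p.1.pert l :=
    measurable_pi_lambda _ fun l => ((measurable_pi_apply l).comp hp).const_div 1
  refine Measurable.ite (hf (measurableSet_singleton false)) ?_ ?_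
  · exact Memory.measurable_mk (hc.add_const 1) measurable_const he
      (measurable_fst.comp measurable_snd) hy
  · refine Memory.measurable_mk hc measurable_const ?_ hp hd
    refine (measurable_proj hF hconv ⟨_, D.init_mem i⟩).comp (he.sub (Measurable.fun_smul ?_ ?_))
    · exact (ha.comp hc).mul ((hd.sub hy).div (hg.comp hc))
    · exact (WithLp.measurable_toLp 2 (Fin n → ℝ)).comp hinv

end MemoryMeasurable

/-! ### Value functions for independent visits to one state -/

section Value

variable {F : Set (EuclideanSpace ℝ (Fin n))} (S : JumpModel K m n) (D : Design K F)
  (ystar : EuclideanSpace ℝ (Fin m)) (i : Fin K)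

/-- The squared input error incurred at a visit to state `i` with memory `M`. -/
def stepError (M : Memory n) (ξ : Stage K m n) : ENNReal :=
  ENNReal.ofReal (‖D.input i M ξ.2.2 - S.optimalInput ystar i‖ ^ 2)

/-- The memory for state `i` after a visit to state `i` with memory `M`. -/
def nextMemory (M : Memory n) (ξ : Stage K m n) : Memory n :=
  D.update ystar i M ξ.2.2 (S.meanOutput ξ.1 (D.input i M ξ.2.2) + ξ.2.1)

/-- The expected cumulative squared input error over `r` visits to state `i`, starting with memory
`M`, when the data of successive visits are independent. -/
def value : ℕ → Memory n → ENNReal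
  | 0, _ => 0
  | r + 1, M => ∫⁻ ξ, stepError S D ystar i M ξ + value r (nextMemory S D ystar i M ξ)
      ∂(stageLaw S D i)

theorem measurable_stepError :
    Measurable fun p : Memory n × Stage K m n => stepError S D ystar i p.1 p.2 := by
  have : Measurable fun p : Memory n × Stage K m n => D.input i p.1 p.2.2.2 :=
    (D.measurable_input i).comp (by fun_prop : Measurable
      fun p : Memory n × Stage K m n => (p.1, p.2.2.2))
  exact ((this.sub_const _).norm.pow_const 2).ennreal_ofReal

variable {D}

theorem measurable_nextMemory (hF : IsCompact F) (hconv : Convex ℝ F) :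
    Measurable fun p : Memory n × Stage K m n => nextMemory S D ystar i p.1 p.2 := by
  have hx : Measurable fun p : Memory n × Stage K m n => D.input i p.1 p.2.2.2 :=
    (D.measurable_input i).comp (by fun_prop : Measurable
      fun p : Memory n × Stage K m n => (p.1, p.2.2.2))
  have hj : Measurable fun p : Memory n × Stage K m n => p.2.1 := by fun_prop
  have hw : Measurable fun p : Memory n × Stage K m n => p.2.2.1 := by fun_prop
  have hδ : Measurable fun p : Memory n × Stage K m n => p.2.2.2 := by fun_prop
  have hy := ((measurable_meanOutput S).comp (hj.prodMk hx)).add hw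
  exact (D.measurable_update i hF hconv ystar).comp (measurable_fst.prodMk (hδ.prodMk hy))

theorem measurable_value (hF : IsCompact F) (hconv : Convex ℝ F) (r : ℕ) :
    Measurable (value S D ystar i r) := by
  have := isProbabilityMeasure_stageLaw S D i
  induction r with
  | zero => exact measurable_const
  | succ r ih => exact ((measurable_stepError S D ystar i).add
      (ih.comp (measurable_nextMemory S ystar i hF hconv))).lintegral_prod_right'

variable (D)

theorem value_le_succ (r : ℕ) (M : Memory n) :
    value S D ystar i r M ≤ value S D ystar i (r + 1) M := by
  induction r generalizing M with
  | zero => exact zero_le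
  | succ r ih => exact lintegral_mono fun ξ => add_le_add le_rfl (ih _)

theorem value_mono {r s : ℕ} (h : r ≤ s) (M : Memory n) :
    value S D ystar i r M ≤ value S D ystar i s M :=
  monotone_nat_of_le_succ (f := fun r => value S D ystar i r M)
    (fun r => value_le_succ S D ystar i r M) h

/-- The memories of all states after a stage whose previous state is `i`. -/
def nextMemories (μ : Fin K → Memory n) (ξ : Stage K m n) : Fin K → Memory n :=
  Function.update μ i (nextMemory S D ystar i (μ i) ξ)

/-- The sum over all states of the expected errors over `r` further visits. -/
def totalValue (r : ℕ) (μ : Fin K → Memory n) : ENNReal := ∑ j, value S D ystar j r (μ j)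

variable {D}

theorem measurable_nextMemories (hF : IsCompact F) (hconv : Convex ℝ F) :
    Measurable fun p : (Fin K → Memory n) × Stage K m n => nextMemories S D ystar i p.1 p.2 := by
  refine measurable_pi_iff.2 fun j => ?_
  rcases eq_or_ne j i with rfl | hne
  · simp only [nextMemories, Function.update_self]
    exact (measurable_nextMemory S ystar j hF hconv).comp (by fun_prop :
      Measurable fun p : (Fin K → Memory n) × Stage K m n => (p.1 j, p.2))
  · simp only [nextMemories, Function.update_of_ne hne]
    exact (measurable_pi_apply j).comp measurable_fst

theorem measurable_totalValue (hF : IsCompact F) (hconv : Convex ℝ F) (r : ℕ) :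
    Measurable (totalValue S D ystar r) :=
  Finset.measurable_sum _ fun j _ =>
    (measurable_value S ystar j hF hconv r).comp (measurable_pi_apply j)

/-- For the current state this is the defining recursion of `value`. The other memories are
unchanged, and their horizon is raised from `r` to `r + 1` by monotonicity. -/
theorem lintegral_stepError_add_totalValue_le (r : ℕ)
    (μ : Fin K → Memory n) :
    ∫⁻ ξ, stepError S D ystar i (μ i) ξ + totalValue S D ystar r (nextMemories S D ystar i μ ξ)
      ∂(stageLaw S D i) ≤ totalValue S D ystar (r + 1) μ := by
  have := isProbabilityMeasure_stageLaw S D i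
  have hsplit (ξ : Stage K m n) : stepError S D ystar i (μ i) ξ +
      totalValue S D ystar r (nextMemories S D ystar i μ ξ) =
      (∑ j ∈ univ.erase i, value S D ystar j r (μ j)) +
      (stepError S D ystar i (μ i) ξ + value S D ystar i r (nextMemory S D ystar i (μ i) ξ)) := by
    rw [totalValue, ← sum_erase_add _ _ (mem_univ i), nextMemories, Function.update_self,
      add_left_comm]
    congr 1
    exact sum_congr rfl fun j hj => by rw [Function.update_of_ne (ne_of_mem_erase hj)]
  simp only [hsplit]
  rw [lintegral_add_left measurable_const, lintegral_const, measure_univ, mul_one,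
    totalValue, ← sum_erase_add _ _ (mem_univ i)]
  exact add_le_add (sum_le_sum fun j _ => value_le_succ S D ystar j r (μ j)) le_rfl

end Value

/-! ### From the closed loop to independent visits -/

section Trajectory

variable {F : Set (EuclideanSpace ℝ (Fin n))} (S : JumpModel K m n) (D : Design K F)
  (ystar : EuclideanSpace ℝ (Fin m))

theorem memory_succ (ω : ℕ → Stage K m n) (t : ℕ) : memory S D ystar ω (t + 1) =
    nextMemories S D ystar (ω t).1 (memory S D ystar ω t) (ω (t + 1)) := rfl

/-- Causality of the policy, needed to treat the memory at time `t` as a function of the history on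
which the Markov property conditions. -/
theorem memory_congr {ω ω' : ℕ → Stage K m n} {t : ℕ} (h : ∀ u ≤ t, ω u = ω' u) :
    memory S D ystar ω t = memory S D ystar ω' t := by
  induction t with
  | zero => rfl
  | succ t ih =>
    rw [memory_succ, memory_succ, ih fun u hu => h u (by omega), h t (by omega), h (t + 1) le_rfl]

variable {D}

theorem measurable_memory (hF : IsCompact F) (hconv : Convex ℝ F) (t : ℕ) :
    Measurable fun ω : ℕ → Stage K m n => memory S D ystar ω t := by
  induction t with
  | zero => exact measurable_const
  | succ t ih =>
    have hstep : Measurable fun p : Fin K × (Fin K → Memory n) × Stage K m n =>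
        nextMemories S D ystar p.1 p.2.1 p.2.2 :=
      measurable_from_prod_countable_right fun i => measurable_nextMemories S ystar i hF hconv
    have h1 : Measurable fun ω : ℕ → Stage K m n => (ω t).1 :=
      measurable_fst.comp (measurable_pi_apply t)
    exact hstep.comp (h1.prodMk (ih.prodMk (measurable_pi_apply (t + 1))))

theorem isProbabilityMeasure_initLaw : IsProbabilityMeasure (initLaw S) := by
  constructor
  simp only [initLaw, Measure.coe_finsetSum, Finset.sum_apply, Measure.smul_apply,
    measure_univ, smul_eq_mul, mul_one]
  rw [← ENNReal.ofReal_sum_of_nonneg fun j _ => S.π₀_nonneg j, S.π₀_sum, ENNReal.ofReal_one]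

variable (D) in
theorem isProbabilityMeasure_law : IsProbabilityMeasure (law S D) := by
  have := isProbabilityMeasure_initLaw S
  rw [law]
  infer_instance

variable (D) in
/-- The Markov property of `law`. -/
theorem lintegral_law_succ (t : ℕ)
    {Φ : ((l : Finset.Iic t) → (fun _ : ℕ => Stage K m n) l) × Stage K m n → ENNReal}
    (hΦ : Measurable Φ) :
    ∫⁻ ω, Φ (Preorder.frestrictLe t ω, ω (t + 1)) ∂(law S D) =
      ∫⁻ ω, ∫⁻ ξ, Φ (Preorder.frestrictLe t ω, ξ) ∂(stageLaw S D (ω t).1) ∂(law S D) := by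
  have := isProbabilityMeasure_initLaw S
  have := isProbabilityMeasure_law S D
  have h := Kernel.map_frestrictLe_trajMeasure_compProd_eq_map_trajMeasure
    (X := fun _ => Stage K m n) (μ₀ := initLaw S) (κ := stageKernel S D) (a := t)
  have hm := Preorder.measurable_frestrictLe (X := fun _ => Stage K m n) t
  have h1 := lintegral_map (μ := law S D) hΦ (hm.prodMk (measurable_pi_apply (t + 1)))
  rw [← h1, law, ← h, Measure.lintegral_compProd hΦ, lintegral_map
    (Measurable.lintegral_kernel_prod_right' hΦ) hm]
  rfl

/-- A trajectory that extends a trajectory known up to time `t`. -/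
def extend (t : ℕ) (h : (l : Finset.Iic t) → (fun _ : ℕ => Stage K m n) l) : ℕ → Stage K m n :=
  fun u => h ⟨min u t, Finset.mem_Iic.2 (min_le_right u t)⟩

theorem measurable_extend (t : ℕ) : Measurable (extend (K := K) (m := m) (n := n) t) :=
  measurable_pi_lambda _ fun _ => measurable_pi_apply _

theorem extend_frestrictLe {t u : ℕ} (hu : u ≤ t) (ω : ℕ → Stage K m n) :
    extend t (Preorder.frestrictLe (π := fun _ => Stage K m n) t ω) u = ω u := by
  simp [extend, hu]

variable (D)

/-- The squared input error at stage `t + 1`. -/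
def errorAt (ω : ℕ → Stage K m n) (t : ℕ) : ENNReal :=
  ENNReal.ofReal (‖policyInput S D ystar ω t - S.optimalInput ystar (ω t).1‖ ^ 2)

theorem measurable_stepError_state :
    Measurable fun p : Fin K × (Fin K → Memory n) × Stage K m n =>
      stepError S D ystar p.1 (p.2.1 p.1) p.2.2 := by
  refine measurable_from_prod_countable_right fun i => ?_
  have h : Measurable fun p : (Fin K → Memory n) × Stage K m n => (p.1 i, p.2) := by fun_prop
  have := (measurable_stepError S D ystar i).comp h
  exact this

variable {D}

theorem measurable_errorAt (hF : IsCompact F) (hconv : Convex ℝ F) (t : ℕ) :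
    Measurable fun ω => errorAt S D ystar ω t := by
  have h1 : Measurable fun ω : ℕ → Stage K m n => (ω t).1 :=
    measurable_fst.comp (measurable_pi_apply t)
  have h2 (ω : ℕ → Stage K m n) : errorAt S D ystar ω t =
      stepError S D ystar (ω t).1 (memory S D ystar ω t (ω t).1) (ω (t + 1)) := rfl
  simp only [h2]
  have h3 := h1.prodMk
    ((measurable_memory S (D := D) ystar hF hconv t).prodMk (measurable_pi_apply (t + 1)))
  have := (measurable_stepError_state S D ystar).comp h3
  exact this

theorem lintegral_errorAt_add_totalValue_le (hF : IsCompact F) (hconv : Convex ℝ F) (r t : ℕ) :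
    ∫⁻ ω, errorAt S D ystar ω t + totalValue S D ystar r (memory S D ystar ω (t + 1))
      ∂(law S D) ≤ ∫⁻ ω, totalValue S D ystar (r + 1) (memory S D ystar ω t) ∂(law S D) := by
  let Ψ : Fin K × (Fin K → Memory n) × Stage K m n → ENNReal := fun p =>
    stepError S D ystar p.1 (p.2.1 p.1) p.2.2 +
      totalValue S D ystar r (nextMemories S D ystar p.1 p.2.1 p.2.2)
  have hΨ : Measurable Ψ := (measurable_stepError_state S D ystar).add
    ((measurable_totalValue S ystar hF hconv r).comp
      (measurable_from_prod_countable_right fun i => measurable_nextMemories S ystar i hF hconv))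
  -- The Markov property takes functions of the restricted history, so the state and the memory are
  -- evaluated on its extension, which agrees with `ω` up to time `t`.
  let Φ : ((l : Finset.Iic t) → (fun _ : ℕ => Stage K m n) l) × Stage K m n → ENNReal := fun q =>
    Ψ ((extend t q.1 t).1, memory S D ystar (extend t q.1) t, q.2)
  have hΦ : Measurable Φ := by
    have he : Measurable fun q : ((l : Finset.Iic t) → (fun _ : ℕ => Stage K m n) l) ×
        Stage K m n => extend t q.1 := (measurable_extend t).comp measurable_fst
    exact hΨ.comp ((measurable_fst.comp ((measurable_pi_apply t).comp he)).prodMk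
      (((measurable_memory S ystar hF hconv t).comp he).prodMk measurable_snd))
  have hval (ω : ℕ → Stage K m n) (ξ : Stage K m n) :
      Φ (Preorder.frestrictLe t ω, ξ) = Ψ ((ω t).1, memory S D ystar ω t, ξ) := by
    simp only [Φ]
    rw [extend_frestrictLe le_rfl,
      memory_congr S D ystar fun u hu => extend_frestrictLe hu ω]
  calc ∫⁻ ω, errorAt S D ystar ω t + totalValue S D ystar r (memory S D ystar ω (t + 1)) ∂(law S D)
      = ∫⁻ ω, Φ (Preorder.frestrictLe t ω, ω (t + 1)) ∂(law S D) := by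
        refine lintegral_congr fun ω => ?_
        rw [hval]
        rfl
    _ = ∫⁻ ω, ∫⁻ ξ, Φ (Preorder.frestrictLe t ω, ξ) ∂(stageLaw S D (ω t).1) ∂(law S D) :=
        lintegral_law_succ S D t hΦ
    _ ≤ _ := by
        refine lintegral_mono fun ω => ?_
        simp only [hval]
        exact lintegral_stepError_add_totalValue_le S ystar (ω t).1 r _

theorem lintegral_sum_errorAt_le (hF : IsCompact F) (hconv : Convex ℝ F) (r t : ℕ) :
    ∫⁻ ω, ∑ u ∈ range r, errorAt S D ystar ω (t + u) ∂(law S D) ≤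
      ∫⁻ ω, totalValue S D ystar r (memory S D ystar ω t) ∂(law S D) := by
  induction r generalizing t with
  | zero => simp
  | succ r ih =>
    refine le_trans ?_ (lintegral_errorAt_add_totalValue_le S ystar hF hconv r t)
    simp only [sum_range_succ', add_zero, add_comm _ (errorAt S D ystar _ t)]
    rw [lintegral_add_left (measurable_errorAt S ystar hF hconv t),
      lintegral_add_left (measurable_errorAt S ystar hF hconv t)]
    simpa only [add_assoc, add_comm 1] using add_le_add le_rfl (ih (t + 1))

/-- The expected cumulative error is at most the sum over the states of the expected errors of
`T` independent visits. -/
theorem lintegral_inputError_le (hF : IsCompact F) (hconv : Convex ℝ F) (T : ℕ) :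
    ∫⁻ ω, ENNReal.ofReal (inputError S D ystar ω T) ∂(law S D) ≤
      ∑ j, value S D ystar j T (D.initMemory j) := by
  have := isProbabilityMeasure_law S D
  have h := lintegral_sum_errorAt_le S (D := D) ystar hF hconv T 0
  simp only [zero_add, memory, totalValue, lintegral_const, measure_univ, mul_one] at h
  refine le_trans (le_of_eq (lintegral_congr fun ω => ?_)) h
  rw [inputError, ENNReal.ofReal_sum_of_nonneg fun _ _ => sq_nonneg _]
  rfl

end Trajectory

/-! ### Mean square of one stochastic gradient step -/

section QuadraticBound

theorem lintegral_ofReal_le_ofReal_integral {Ω : Type*} [MeasurableSpace Ω] {μ : Measure Ω}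
    {f g : Ω → ℝ} (hg : Integrable g μ) (hf : ∀ x, 0 ≤ f x) (hfg : ∀ᵐ x ∂μ, f x ≤ g x) :
    ∫⁻ x, ENNReal.ofReal (f x) ∂μ ≤ ENNReal.ofReal (∫ x, g x ∂μ) := by
  rw [ofReal_integral_eq_lintegral_ofReal hg (hfg.mono fun x hx => (hf x).trans hx)]
  exact lintegral_mono_ae (hfg.mono fun x hx => ENNReal.ofReal_le_ofReal hx)

variable {E : Type*} [NormedAddCommGroup E] [InnerProductSpace ℝ E]

/-- Bounding `(x - y)²` by `2x² + 2y²` separates the two observations, so only their individual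
first and second moments enter. -/
theorem norm_sub_smul_sq_le (u η : E) (s x y : ℝ) :
    ‖u - (s * (x - y)) • η‖ ^ 2 ≤
      (‖u‖ ^ 2 - 2 * s * x * inner ℝ u η + 2 * s ^ 2 * ‖η‖ ^ 2 * x ^ 2) +
        (2 * s * inner ℝ u η) * y + (2 * s ^ 2 * ‖η‖ ^ 2) * y ^ 2 := by
  rw [norm_sub_sq_real, real_inner_smul_right, norm_smul, mul_pow, Real.norm_eq_abs, sq_abs]
  nlinarith [mul_nonneg (mul_nonneg (sq_nonneg s) (sq_nonneg ‖η‖)) (sq_nonneg (x + y))]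

theorem integral_quadratic {Ω : Type*} [MeasurableSpace Ω] {ρ : Measure Ω}
    [IsProbabilityMeasure ρ] {Z : Ω → ℝ} (hZ : Integrable Z ρ)
    (hZ2 : Integrable (fun o => Z o ^ 2) ρ) (p q r : ℝ) :
    Integrable (fun o => p + q * Z o + r * Z o ^ 2) ρ ∧
      ∫ o, p + q * Z o + r * Z o ^ 2 ∂ρ = p + q * ∫ o, Z o ∂ρ + r * ∫ o, Z o ^ 2 ∂ρ := by
  have h1 : Integrable (fun o => p + q * Z o) ρ := (integrable_const _).add (hZ.const_mul _)
  refine ⟨h1.add (hZ2.const_mul _), ?_⟩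
  rw [integral_add h1 (hZ2.const_mul _), integral_add (integrable_const _) (hZ.const_mul _),
    integral_const_mul, integral_const_mul, integral_const, probReal_univ, one_smul]

/-- The bound contains a signed drift term. Its nonnegativity is recorded so that `ENNReal.ofReal`
can later be exchanged with the integral over the perturbation, where the drift is averaged. -/
theorem lintegral_norm_sub_smul_sq_le {Ω : Type*} [MeasurableSpace Ω] {ρ : Measure Ω}
    [IsProbabilityMeasure ρ] {X Y : Ω → ℝ} (hX : Integrable X ρ) (hY : Integrable Y ρ)
    (hX2 : Integrable (fun o => X o ^ 2) ρ) (hY2 : Integrable (fun o => Y o ^ 2) ρ) {Q : ℝ}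
    (hXQ : ∫ o, X o ^ 2 ∂ρ ≤ Q) (hYQ : ∫ o, Y o ^ 2 ∂ρ ≤ Q) (u η : E) (s : ℝ) :
    0 ≤ ‖u‖ ^ 2 - 2 * s * (∫ o, X o ∂ρ - ∫ o, Y o ∂ρ) * inner ℝ u η +
        4 * Q * s ^ 2 * ‖η‖ ^ 2 ∧
      ∫⁻ o, ∫⁻ o', ENNReal.ofReal (‖u - (s * (X o - Y o')) • η‖ ^ 2) ∂ρ ∂ρ ≤
        ENNReal.ofReal (‖u‖ ^ 2 - 2 * s * (∫ o, X o ∂ρ - ∫ o, Y o ∂ρ) * inner ℝ u η +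
          4 * Q * s ^ 2 * ‖η‖ ^ 2) := by
  set t : ℝ := inner ℝ u η
  set N : ℝ := ‖η‖ ^ 2
  set EX := ∫ o, X o ∂ρ
  set EY := ∫ o, Y o ∂ρ
  have hN : 0 ≤ 2 * s ^ 2 * N := by positivity
  let R : ℝ → ℝ := fun x => (‖u‖ ^ 2 - 2 * s * x * t + 2 * s ^ 2 * N * x ^ 2) +
    (2 * s * t) * EY + (2 * s ^ 2 * N) * ∫ o, Y o ^ 2 ∂ρ
  have heq (x : ℝ) := integral_quadratic hY hY2
    (‖u‖ ^ 2 - 2 * s * x * t + 2 * s ^ 2 * N * x ^ 2) (2 * s * t) (2 * s ^ 2 * N)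
  have hin (x : ℝ) : ∫⁻ o', ENNReal.ofReal (‖u - (s * (x - Y o')) • η‖ ^ 2) ∂ρ ≤
      ENNReal.ofReal (R x) := by
    simp only [R, EY, ← (heq x).2]
    exact lintegral_ofReal_le_ofReal_integral (heq x).1 (fun _ => sq_nonneg _)
      (Filter.Eventually.of_forall fun o => norm_sub_smul_sq_le u η s x (Y o))
  have hR0 (x : ℝ) : 0 ≤ R x := by
    simp only [R, EY, ← (heq x).2]
    exact integral_nonneg fun o => (sq_nonneg _).trans (norm_sub_smul_sq_le u η s x (Y o))
  have hRX : (fun o => R (X o)) = fun o => (‖u‖ ^ 2 + (2 * s * t) * EY +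
      (2 * s ^ 2 * N) * ∫ o, Y o ^ 2 ∂ρ) + (-(2 * s * t)) * X o + (2 * s ^ 2 * N) * X o ^ 2 := by
    funext o
    simp only [R]
    ring
  have hRq := integral_quadratic hX hX2 (‖u‖ ^ 2 + (2 * s * t) * EY +
    (2 * s ^ 2 * N) * ∫ o, Y o ^ 2 ∂ρ) (-(2 * s * t)) (2 * s ^ 2 * N)
  rw [← hRX] at hRq
  have hReq : ∫ o, R (X o) ∂ρ = ‖u‖ ^ 2 - 2 * s * (EX - EY) * t +
      (2 * s ^ 2 * N) * ((∫ o, X o ^ 2 ∂ρ) + ∫ o, Y o ^ 2 ∂ρ) := by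
    rw [hRq.2]
    simp only [EX]
    ring
  have hle : ∫ o, R (X o) ∂ρ ≤ ‖u‖ ^ 2 - 2 * s * (EX - EY) * t + 4 * Q * s ^ 2 * N := by
    rw [hReq]
    nlinarith [mul_le_mul_of_nonneg_left (add_le_add hXQ hYQ) hN]
  refine ⟨(integral_nonneg fun o => hR0 (X o)).trans hle,
    ((lintegral_mono fun o => hin (X o)).trans ?_).trans (ENNReal.ofReal_le_ofReal hle)⟩
  rw [ofReal_integral_eq_lintegral_ofReal hRq.1 (Filter.Eventually.of_forall fun o => hR0 (X o))]

end QuadraticBound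

/-! ### Mean square contraction of the estimate -/

section Drift

variable {F : Set (EuclideanSpace ℝ (Fin n))}
  {Θ : Set (Fin K → Matrix (Fin m) (Fin n) ℝ × EuclideanSpace ℝ (Fin m))} {σ : ℝ}
  {S : JumpModel K m n} {D : Design K F} {ystar : EuclideanSpace ℝ (Fin m)} {i : Fin K}

theorem Design.gain_pos (D : Design K F) (i : Fin K) (k : ℕ) : 0 < D.gain i (k + 1) := by
  have := D.γ'_pos i
  rw [Design.gain]
  push_cast
  positivity

/-- One update of the estimate contracts the mean square error, up to a term of order
`(a_k / c_k)²`. -/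
theorem lintegral_estimate_update_le (hS : Admissible ystar F Θ σ S)
    (hγ : D.StepSizeCondition S) (k : ℕ) (e : EuclideanSpace ℝ (Fin n)) {Q : ℝ}
    (hQ : ∀ δ : EuclideanSpace ℝ (Fin n), ‖δ‖ ^ 2 ≤ n * D.ξ₁ ^ 2 →
      ∫ o, outcomeCost S ystar (e + D.gain i (k + 1) • δ) o ^ 2 ∂(outcomeLaw S i) ≤ Q ∧
      ∫ o, outcomeCost S ystar (e - D.gain i (k + 1) • δ) o ^ 2 ∂(outcomeLaw S i) ≤ Q) :
    ∫⁻ δ, ∫⁻ o, ∫⁻ o', ENNReal.ofReal (‖(e - S.optimalInput ystar i) -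
        (D.stepSize i (k + 1) / D.gain i (k + 1) *
          (outcomeCost S ystar (e + D.gain i (k + 1) • WithLp.toLp 2 δ) o -
            outcomeCost S ystar (e - D.gain i (k + 1) • WithLp.toLp 2 δ) o')) •
          WithLp.toLp 2 (fun l => 1 / δ l)‖ ^ 2)
      ∂(outcomeLaw S i) ∂(outcomeLaw S i) ∂(Measure.pi fun _ : Fin n => D.ν) ≤
    ENNReal.ofReal ((D.N i + k) / (D.N i + k + 1) * ‖e - S.optimalInput ystar i‖ ^ 2 +
      4 * Q * (D.stepSize i (k + 1) / D.gain i (k + 1)) ^ 2 * (n * D.ξ₂)) := by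
  have := D.ν_prob
  set c := D.gain i (k + 1) with hc
  set a := D.stepSize i (k + 1) with ha
  have hcpos : 0 < c := D.gain_pos i k
  set u := e - S.optimalInput ystar i with hu
  set G := (S.gram i).toEuclideanLin u with hG
  have hξ₂ := D.ξ₂_pos.le
  have hQ0 : 0 ≤ Q := (integral_nonneg fun _ => sq_nonneg _).trans (hQ 0 (by
    rw [norm_zero, zero_pow two_ne_zero]
    positivity)).1
  -- The bound at fixed `δ`. The gain cancels in the drift: `2 (a/c) · 4c = 8a`.
  let R : (Fin n → ℝ) → ℝ := fun δ => ‖u‖ ^ 2 - 8 * a * (inner ℝ (WithLp.toLp 2 δ) G *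
    inner ℝ u (WithLp.toLp 2 fun l => 1 / δ l)) + 4 * Q * (a / c) ^ 2 *
      ‖(WithLp.toLp 2 fun l => 1 / δ l : EuclideanSpace ℝ (Fin n))‖ ^ 2
  have hae : ∀ᵐ δ ∂(Measure.pi fun _ : Fin n => D.ν), 0 ≤ R δ ∧
      ∫⁻ o, ∫⁻ o', ENNReal.ofReal (‖u - (a / c *
          (outcomeCost S ystar (e + c • WithLp.toLp 2 δ) o -
            outcomeCost S ystar (e - c • WithLp.toLp 2 δ) o')) •
          WithLp.toLp 2 (fun l => 1 / δ l)‖ ^ 2) ∂(outcomeLaw S i) ∂(outcomeLaw S i) ≤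
        ENNReal.ofReal (R δ) := by
    filter_upwards [ae_norm_sq_le (n := n) D.ν_bound] with δ hδ
    have h := lintegral_norm_sub_smul_sq_le
      (integrable_outcomeCost i hS (e + c • WithLp.toLp 2 δ))
      (integrable_outcomeCost i hS (e - c • WithLp.toLp 2 δ))
      (integrable_outcomeCost_sq i hS _) (integrable_outcomeCost_sq i hS _)
      (hQ _ hδ).1 (hQ _ hδ).2 u (WithLp.toLp 2 fun l => 1 / δ l) (a / c)
    have hR : R δ = ‖u‖ ^ 2 - 2 * (a / c) *
        (∫ o, outcomeCost S ystar (e + c • WithLp.toLp 2 δ) o ∂(outcomeLaw S i) -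
          ∫ o, outcomeCost S ystar (e - c • WithLp.toLp 2 δ) o ∂(outcomeLaw S i)) *
        inner ℝ u (WithLp.toLp 2 fun l => 1 / δ l) + 4 * Q * (a / c) ^ 2 *
        ‖(WithLp.toLp 2 fun l => 1 / δ l : EuclideanSpace ℝ (Fin n))‖ ^ 2 := by
      rw [integral_outcomeCost_add_sub i hS, real_inner_smul_left]
      simp only [R]
      field_simp
      ring
    rw [hR]
    exact h
  have hI1 := integral_inner_mul_inner_inv D.ν_bound D.ν_symm D.ν_inv_sq hξ₂ G u
  have hI2 := integral_norm_inv_sq_le (n := n) D.ν_inv_sq hξ₂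
  have hi1 := (integrable_const (μ := Measure.pi fun _ : Fin n => D.ν) (‖u‖ ^ 2)).sub
    (hI1.1.const_mul (8 * a))
  have hi2 := hI2.1.const_mul (4 * Q * (a / c) ^ 2)
  have hRint : Integrable R (Measure.pi fun _ : Fin n => D.ν) := hi1.add hi2
  have hReq : ∫ δ, R δ ∂(Measure.pi fun _ : Fin n => D.ν) =
      ‖u‖ ^ 2 - 8 * a * inner ℝ u G + 4 * Q * (a / c) ^ 2 *
        ∫ δ : Fin n → ℝ, ‖(WithLp.toLp 2 fun l => 1 / δ l : EuclideanSpace ℝ (Fin n))‖ ^ 2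
          ∂(Measure.pi fun _ => D.ν) := by
    have h1 := integral_add hi1 hi2
    have h2 := integral_sub (integrable_const (μ := Measure.pi fun _ : Fin n => D.ν) (‖u‖ ^ 2))
      (hI1.1.const_mul (8 * a))
    rw [integral_const_mul] at h1
    rw [integral_const_mul, hI1.2] at h2
    simp only [Pi.sub_apply] at h1
    rw [h2] at h1
    simp only [R]
    simpa using h1
  refine (lintegral_mono_ae (hae.mono fun δ h => h.2)).trans ?_
  rw [← ofReal_integral_eq_lintegral_ofReal hRint (hae.mono fun δ h => h.1), hReq]
  refine ENNReal.ofReal_le_ofReal ?_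
  -- This is where the step-size condition enters: `8γ⟨u, Gu⟩ ≥ ‖u‖²`, divided by `N + k + 1`.
  have hdrift : ‖u‖ ^ 2 / (D.N i + k + 1) ≤ 8 * a * inner ℝ u G := by
    have h := JumpModel.norm_sq_le_gram i hS.rank_eq (D.γ_pos i) (hγ i) u
    have hin : inner ℝ u G = ∑ j, S.P i j * ‖(S.A j).toEuclideanLin u‖ ^ 2 := by
      simp only [hG, S.inner_gram, real_inner_self_eq_norm_sq]
    rw [hin, ha, Design.stepSize]
    push_cast
    rw [← add_assoc, div_le_iff₀ (by positivity)]
    refine h.trans_eq ?_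
    field_simp
  have hsplit : (D.N i + k : ℝ) / (D.N i + k + 1) * ‖u‖ ^ 2 =
      ‖u‖ ^ 2 - ‖u‖ ^ 2 / (D.N i + k + 1) := by
    field_simp
    ring
  have hq : 0 ≤ 4 * Q * (a / c) ^ 2 := by positivity
  rw [hsplit]
  nlinarith [mul_le_mul_of_nonneg_left hI2.2 hq]

end Drift

/-! ### A pair of visits, and the backward induction -/

section TwoSteps

variable {F : Set (EuclideanSpace ℝ (Fin n))}
  {Θ : Set (Fin K → Matrix (Fin m) (Fin n) ℝ × EuclideanSpace ℝ (Fin m))} {σ : ℝ}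
  {S : JumpModel K m n} {D : Design K F} {ystar : EuclideanSpace ℝ (Fin m)} {i : Fin K}

theorem nextMemory_of_not_flag {M : Memory n} (h : M.flag = false) (j : Fin K)
    (w : EuclideanSpace ℝ (Fin m)) (δ : Fin n → ℝ) :
    nextMemory S D ystar i M (j, w, δ) = ⟨M.count + 1, true, M.est, δ,
      outcomeCost S ystar (M.est + D.gain i (M.count + 1) • WithLp.toLp 2 δ) (j, w)⟩ := by
  simp [nextMemory, Design.update, Design.input, h, outcomeCost]

theorem nextMemory_of_flag {M : Memory n} (h : M.flag = true) (ξ : Stage K m n) :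
    nextMemory S D ystar i M ξ = ⟨M.count, false, proj F (M.est -
      (D.stepSize i M.count / D.gain i M.count * (M.dPlus - outcomeCost S ystar
        (M.est - D.gain i M.count • WithLp.toLp 2 M.pert) (ξ.1, ξ.2.1))) •
          WithLp.toLp 2 (fun l => 1 / M.pert l)), M.pert, M.dPlus⟩ := by
  simp [nextMemory, Design.update, Design.input, h, outcomeCost, mul_div_assoc, div_mul_eq_mul_div]

theorem stepError_of_not_flag {M : Memory n} (h : M.flag = false) (ξ : Stage K m n) :
    stepError S D ystar i M ξ = ENNReal.ofReal (‖(M.est - S.optimalInput ystar i) +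
      D.gain i (M.count + 1) • WithLp.toLp 2 ξ.2.2‖ ^ 2) := by
  simp [stepError, Design.input, h, sub_add_eq_add_sub]

theorem stepError_of_flag {M : Memory n} (h : M.flag = true) (ξ : Stage K m n) :
    stepError S D ystar i M ξ = ENNReal.ofReal (‖(M.est - S.optimalInput ystar i) -
      D.gain i M.count • WithLp.toLp 2 M.pert‖ ^ 2) := by
  rw [stepError, Design.input, if_neg (by simp [h]), sub_right_comm]

theorem norm_add_sq_le_two {E : Type*} [NormedAddCommGroup E] (u v : E) :
    ‖u + v‖ ^ 2 ≤ 2 * ‖u‖ ^ 2 + 2 * ‖v‖ ^ 2 := by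
  have := pow_le_pow_left₀ (norm_nonneg _) (norm_add_le u v) 2
  nlinarith [sq_nonneg (‖u‖ - ‖v‖)]

/-- The effect on the value function of the pair of visits that share one perturbation. -/
theorem value_add_two_le (hF : IsCompact F) (hconv : Convex ℝ F)
    (hS : Admissible ystar F Θ σ S) (hγ : D.StepSizeCondition S) {k r : ℕ} {α β Q : ℝ}
    (hα : 0 ≤ α) (hβ : 0 ≤ β)
    (ih : ∀ M : Memory n, M.flag = false → M.count = k + 1 → M.est ∈ F →
      value S D ystar i r M ≤ ENNReal.ofReal (α * ‖M.est - S.optimalInput ystar i‖ ^ 2 + β))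
    {M : Memory n} (hflag : M.flag = false) (hcount : M.count = k) (hest : M.est ∈ F)
    (hQ : ∀ δ : EuclideanSpace ℝ (Fin n), ‖δ‖ ^ 2 ≤ n * D.ξ₁ ^ 2 →
      ∫ o, outcomeCost S ystar (M.est + D.gain i (k + 1) • δ) o ^ 2 ∂(outcomeLaw S i) ≤ Q ∧
      ∫ o, outcomeCost S ystar (M.est - D.gain i (k + 1) • δ) o ^ 2 ∂(outcomeLaw S i) ≤ Q) :
    value S D ystar i (r + 2) M ≤ ENNReal.ofReal
      (α * ((D.N i + k) / (D.N i + k + 1) * ‖M.est - S.optimalInput ystar i‖ ^ 2 +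
        4 * Q * (D.stepSize i (k + 1) / D.gain i (k + 1)) ^ 2 * (n * D.ξ₂)) + β +
      (4 * ‖M.est - S.optimalInput ystar i‖ ^ 2 +
        4 * D.gain i (k + 1) ^ 2 * (n * D.ξ₁ ^ 2))) := by
  have := D.ν_prob
  have hQ0 : 0 ≤ Q := (integral_nonneg fun _ => sq_nonneg _).trans (hQ 0 (by
    rw [norm_zero, zero_pow two_ne_zero]
    positivity)).1
  have hdrift := lintegral_estimate_update_le hS hγ k M.est hQ
  have hξ₂ := D.ξ₂_pos
  set e := M.est
  set c := D.gain i (k + 1)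
  set a := D.stepSize i (k + 1)
  set u := e - S.optimalInput ystar i
  let W : (Fin n → ℝ) → Fin K × EuclideanSpace ℝ (Fin m) → Fin K × EuclideanSpace ℝ (Fin m) → ℝ :=
    fun δ o o' => ‖u - (a / c * (outcomeCost S ystar (e + c • WithLp.toLp 2 δ) o -
      outcomeCost S ystar (e - c • WithLp.toLp 2 δ) o')) • WithLp.toLp 2 (fun l => 1 / δ l)‖ ^ 2
  -- Bounds the squared input error at each visit of the pair; both use the same estimate, so the
  -- pair costs at most `2κ`.
  let κ : ℝ := 2 * ‖u‖ ^ 2 + 2 * c ^ 2 * (n * D.ξ₁ ^ 2)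
  have hκ : 0 ≤ κ := by positivity
  have hcost {δ : Fin n → ℝ}
      (hδ : ‖(WithLp.toLp 2 δ : EuclideanSpace ℝ (Fin n))‖ ^ 2 ≤ n * D.ξ₁ ^ 2) :
      ‖u + c • WithLp.toLp 2 δ‖ ^ 2 ≤ κ ∧ ‖u - c • WithLp.toLp 2 δ‖ ^ 2 ≤ κ := by
    have hc : ‖c • (WithLp.toLp 2 δ : EuclideanSpace ℝ (Fin n))‖ ^ 2 ≤ c ^ 2 * (n * D.ξ₁ ^ 2) := by
      rw [norm_smul, mul_pow, Real.norm_eq_abs, sq_abs]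
      gcongr
    constructor
    · refine (norm_add_sq_le_two _ _).trans ?_
      simp only [κ]
      linarith
    · rw [sub_eq_add_neg]
      refine (norm_add_sq_le_two _ _).trans ?_
      rw [norm_neg]
      simp only [κ]
      linarith
  have hmv := measurable_value S (D := D) ystar i hF hconv
  have hmn := measurable_nextMemory S (D := D) ystar i hF hconv
  have hme := measurable_stepError S D ystar i
  have hsecond {δ : Fin n → ℝ}
      (hδ : ‖(WithLp.toLp 2 δ : EuclideanSpace ℝ (Fin n))‖ ^ 2 ≤ n * D.ξ₁ ^ 2)
      (o : Fin K × EuclideanSpace ℝ (Fin m)) :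
      value S D ystar i (r + 1) (nextMemory S D ystar i M (o.1, o.2, δ)) ≤
        ENNReal.ofReal (κ + β) +
          ENNReal.ofReal α * ∫⁻ o', ENNReal.ofReal (W δ o o') ∂(outcomeLaw S i) := by
    rw [nextMemory_of_not_flag hflag, hcount]
    set M' : Memory n := ⟨k + 1, true, M.est, δ,
      outcomeCost S ystar (M.est + D.gain i (k + 1) • WithLp.toLp 2 δ) (o.1, o.2)⟩ with hM'
    have hmeas : Measurable fun ξ : Stage K m n => stepError S D ystar i M' ξ +
        value S D ystar i r (nextMemory S D ystar i M' ξ) :=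
      (hme.comp measurable_prodMk_left).add ((hmv r).comp (hmn.comp measurable_prodMk_left))
    rw [value, lintegral_stageLaw i D hmeas, ← lintegral_const_mul' _ _ ENNReal.ofReal_ne_top]
    -- The vector `δ'` drawn at the second visit is ignored because the flag is set; the stored `δ`
    -- is used, so the bound is uniform in `δ'`.
    have hbound (δ' : Fin n → ℝ) : ∫⁻ o', stepError S D ystar i M' (o'.1, o'.2, δ') +
        value S D ystar i r (nextMemory S D ystar i M' (o'.1, o'.2, δ')) ∂(outcomeLaw S i) ≤
        ENNReal.ofReal (κ + β) +
          ∫⁻ o', ENNReal.ofReal α * ENNReal.ofReal (W δ o o') ∂(outcomeLaw S i) := by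
      rw [← mul_one (ENNReal.ofReal (κ + β)), ← measure_univ (μ := outcomeLaw S i),
        ← lintegral_const, ← lintegral_add_left measurable_const]
      refine lintegral_mono fun o' => ?_
      have h1 : stepError S D ystar i M' (o'.1, o'.2, δ') ≤ ENNReal.ofReal κ := by
        rw [stepError_of_flag (by rfl)]
        exact ENNReal.ofReal_le_ofReal (hcost hδ).2
      have h2 : value S D ystar i r (nextMemory S D ystar i M' (o'.1, o'.2, δ')) ≤
          ENNReal.ofReal (α * W δ o o' + β) := by
        rw [nextMemory_of_flag (by rfl)]
        refine (ih _ rfl rfl (proj_spec hF ⟨_, hest⟩ _).1).trans (ENNReal.ofReal_le_ofReal ?_)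
        gcongr
        -- Projecting does not increase the distance to the optimal input, which lies in `F`.
        refine pow_le_pow_left₀ (norm_nonneg _)
          ((norm_proj_sub_le hF hconv _ (hS.optimalInput_mem i)).trans (le_of_eq ?_)) 2
        rw [sub_right_comm]
      refine (add_le_add h1 h2).trans (le_of_eq ?_)
      rw [← ENNReal.ofReal_mul hα, ← ENNReal.ofReal_add hκ (by positivity),
        ← ENNReal.ofReal_add (by positivity) (by positivity)]
      ring_nf
    refine (lintegral_mono hbound).trans ?_
    rw [lintegral_const, measure_univ, mul_one]
  have hmeas : Measurable fun ξ : Stage K m n => stepError S D ystar i M ξ +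
      value S D ystar i (r + 1) (nextMemory S D ystar i M ξ) :=
    (hme.comp measurable_prodMk_left).add ((hmv (r + 1)).comp (hmn.comp measurable_prodMk_left))
  have hfirst : ∀ᵐ δ ∂(Measure.pi fun _ : Fin n => D.ν),
      ∫⁻ o, stepError S D ystar i M (o.1, o.2, δ) +
        value S D ystar i (r + 1) (nextMemory S D ystar i M (o.1, o.2, δ)) ∂(outcomeLaw S i) ≤
      ENNReal.ofReal (2 * κ + β) + ENNReal.ofReal α *
        ∫⁻ o, ∫⁻ o', ENNReal.ofReal (W δ o o') ∂(outcomeLaw S i) ∂(outcomeLaw S i) := by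
    filter_upwards [ae_norm_sq_le (n := n) D.ν_bound] with δ hδ
    rw [← mul_one (ENNReal.ofReal (2 * κ + β)), ← measure_univ (μ := outcomeLaw S i),
      ← lintegral_const, ← lintegral_const_mul' _ _ ENNReal.ofReal_ne_top,
      ← lintegral_add_left measurable_const]
    refine lintegral_mono fun o => ?_
    have h1 : stepError S D ystar i M (o.1, o.2, δ) ≤ ENNReal.ofReal κ := by
      rw [stepError_of_not_flag hflag, hcount]
      exact ENNReal.ofReal_le_ofReal (hcost hδ).1
    refine (add_le_add h1 (hsecond hδ o)).trans (le_of_eq ?_)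
    rw [← add_assoc, ← ENNReal.ofReal_add hκ (by positivity)]
    ring_nf
  rw [value, lintegral_stageLaw i D hmeas]
  refine (lintegral_mono_ae hfirst).trans ?_
  rw [lintegral_add_left measurable_const, lintegral_const_mul' _ _ ENNReal.ofReal_ne_top,
    lintegral_const, measure_univ, mul_one]
  refine (add_le_add le_rfl (mul_le_mul_right hdrift _)).trans (le_of_eq ?_)
  rw [← ENNReal.ofReal_mul hα, ← ENNReal.ofReal_add (by positivity) (by positivity)]
  simp only [κ]
  ring_nf

/-- The value function is dominated by the cumulative sum of any solution `b` of the recursion for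
the mean square errors of the estimates. -/
theorem exists_value_le (hF : IsCompact F) (hconv : Convex ℝ F)
    (hS : Admissible ystar F Θ σ S) (hγ : D.StepSizeCondition S) {Q : ℝ}
    (hQ : ∀ e ∈ F, ∀ k, ∀ δ : EuclideanSpace ℝ (Fin n), ‖δ‖ ^ 2 ≤ n * D.ξ₁ ^ 2 →
      ∫ o, outcomeCost S ystar (e + D.gain i (k + 1) • δ) o ^ 2 ∂(outcomeLaw S i) ≤ Q ∧
      ∫ o, outcomeCost S ystar (e - D.gain i (k + 1) • δ) o ^ 2 ∂(outcomeLaw S i) ≤ Q)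
    (hQ0 : 0 ≤ Q) {b : ℕ → ℝ} (hb : ∀ k, b (k + 1) = (D.N i + k) / (D.N i + k + 1) * b k +
      4 * Q * (D.stepSize i (k + 1) / D.gain i (k + 1)) ^ 2 * (n * D.ξ₂)) (r k : ℕ) :
    ∃ α β : ℝ, 0 ≤ α ∧ 0 ≤ β ∧
      (∀ M : Memory n, M.flag = false → M.count = k → M.est ∈ F → value S D ystar i (2 * r) M ≤
        ENNReal.ofReal (α * ‖M.est - S.optimalInput ystar i‖ ^ 2 + β)) ∧
      α * b k + β = ∑ q ∈ range r,
        (4 * b (k + q) + 4 * D.gain i (k + q + 1) ^ 2 * (n * D.ξ₁ ^ 2)) := by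
  have hξ₂ := D.ξ₂_pos
  induction r generalizing k with
  | zero => exact ⟨0, 0, le_rfl, le_rfl, fun M _ _ _ => zero_le, by simp⟩
  | succ r ih =>
    obtain ⟨α, β, hα, hβ, hval, hsum⟩ := ih (k + 1)
    -- A bound affine in `‖u‖²` stays affine when a pair of visits is prepended: the pair
    -- contributes `4‖u‖²`, and the contraction multiplies `α`. As `b` obeys the same affine
    -- recursion with equality, evaluating the bound at `b k` adds exactly one summand.
    refine ⟨4 + α * ((D.N i + k) / (D.N i + k + 1)),
      4 * D.gain i (k + 1) ^ 2 * (n * D.ξ₁ ^ 2) +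
        α * (4 * Q * (D.stepSize i (k + 1) / D.gain i (k + 1)) ^ 2 * (n * D.ξ₂)) + β,
      by positivity, by positivity, fun M hflag hcount hest => ?_, ?_⟩
    · refine (value_add_two_le hF hconv hS hγ hα hβ hval hflag hcount hest
        (hQ _ hest k)).trans (ENNReal.ofReal_le_ofReal (le_of_eq ?_))
      ring
    · rw [sum_range_succ', add_zero]
      have hre : ∑ q ∈ range r, (4 * b (k + (q + 1)) +
          4 * D.gain i (k + (q + 1) + 1) ^ 2 * (n * D.ξ₁ ^ 2)) = α * b (k + 1) + β := by
        rw [hsum]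
        exact sum_congr rfl fun q _ => by rw [add_assoc k 1 q, add_comm 1 q]
      rw [hre, hb]
      ring

end TwoSteps

/-! ### The recursion and the step-size rates -/

section Rates

theorem sum_inv_sqrt_le (T : ℕ) : ∑ k ∈ range T, 1 / √((k : ℝ) + 1) ≤ 2 * √T := by
  induction T with
  | zero => simp
  | succ T ih =>
    rw [sum_range_succ]
    have hs : 0 < √((T : ℝ) + 1) := by positivity
    have h1 : √((T : ℝ) + 1) ^ 2 = T + 1 := Real.sq_sqrt (by positivity)
    have h2 : √(T : ℝ) ^ 2 = T := Real.sq_sqrt (by positivity)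
    have h3 : 1 / √((T : ℝ) + 1) ≤ 2 * (√((T : ℝ) + 1) - √T) := by
      rw [div_le_iff₀ hs]
      nlinarith [sq_nonneg (√((T : ℝ) + 1) - √T)]
    push_cast
    linarith

/-- A recursion `b_{k+1} = (1 - 1/(N+k+1)) b_k + O(k^{-3/2})` has solutions of order
`k^{-1/2}`. -/
theorem le_div_sqrt_of_recursion {N : ℕ} {b g : ℕ → ℝ} {G : ℝ} (hG : 0 ≤ G) (h0 : 0 ≤ b 0)
    (hb : ∀ k, b (k + 1) = (N + k) / (N + k + 1) * b k + g k)
    (hg : ∀ k, (N + k + 1) * g k ≤ G * (1 / √((k : ℝ) + 1))) (k : ℕ) :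
    b k ≤ (2 * (N * b 0 + 2 * G) + b 0) * (1 / √((k : ℝ) + 1)) := by
  -- Multiplying the recursion by `N + k + 1` makes it telescope.
  have hsum (k : ℕ) : (N + k) * b k ≤
      N * b 0 + G * ∑ q ∈ range k, 1 / √((q : ℝ) + 1) := by
    induction k with
    | zero => simp
    | succ k ih =>
      have h1 : ((N : ℝ) + (k + 1 : ℕ)) * b (k + 1) = (N + k) * b k + (N + k + 1) * g k := by
        rw [hb]
        push_cast
        field_simp
        ring
      rw [h1, sum_range_succ, mul_add]
      linarith [hg k]
  rcases Nat.eq_zero_or_pos k with rfl | hk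
  · simp only [Nat.cast_zero, zero_add, Real.sqrt_one, div_one, mul_one]
    nlinarith [mul_nonneg (Nat.cast_nonneg (α := ℝ) N) h0]
  have hk1 : (1 : ℝ) ≤ k := by exact_mod_cast hk
  set s := √((k : ℝ) + 1)
  have hs : 0 < s := by positivity
  have hs2 : s ^ 2 = k + 1 := Real.sq_sqrt (by positivity)
  have hs1 : 1 ≤ s := Real.one_le_sqrt.2 (by linarith)
  have hrs : √(k : ℝ) ≤ s := Real.sqrt_le_sqrt (by linarith)
  have hNb : 0 ≤ N * b 0 := mul_nonneg (Nat.cast_nonneg N) h0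
  have hmain : (N + k) * b k ≤ (N * b 0 + 2 * G) * s := by
    refine (hsum k).trans ?_
    have := mul_le_mul_of_nonneg_left ((sum_inv_sqrt_le k).trans
      (mul_le_mul_of_nonneg_left hrs zero_le_two)) hG
    nlinarith
  rw [mul_one_div, le_div_iff₀ hs]
  rcases le_or_gt (b k) 0 with hneg | hpos
  · nlinarith
  have hkb : k * b k ≤ (N * b 0 + 2 * G) * s := by
    nlinarith [mul_nonneg (Nat.cast_nonneg (α := ℝ) N) hpos.le]
  -- The factor `2` comes from `k + 1 ≤ 2k` for `k ≥ 1`.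
  have h2 : s ^ 2 * b k ≤ 2 * ((N * b 0 + 2 * G) * s) := by
    rw [hs2]
    nlinarith
  have h3 : (b k * s) * s ≤ (2 * (N * b 0 + 2 * G)) * s := by linarith
  linarith [le_of_mul_le_mul_right h3 hs]

variable {F : Set (EuclideanSpace ℝ (Fin n))} (D : Design K F) (i : Fin K) (k : ℕ)

theorem Design.gain_sq : D.gain i (k + 1) ^ 2 = D.γ' i ^ 2 / √(D.N' i + k + 1) := by
  have h : ((D.N' i + k + 1 : ℝ) ^ (1 / 4 : ℝ)) ^ 2 = √(D.N' i + k + 1) := by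
    rw [← Real.rpow_natCast, ← Real.rpow_mul (by positivity), Real.sqrt_eq_rpow]
    norm_num
  rw [Design.gain, div_pow]
  push_cast
  rw [← add_assoc, h]

theorem Design.gain_sq_le : D.gain i (k + 1) ^ 2 ≤ D.γ' i ^ 2 * (1 / √((k : ℝ) + 1)) := by
  rw [D.gain_sq, mul_one_div]
  gcongr
  linarith [Nat.cast_nonneg (α := ℝ) (D.N' i)]

theorem Design.gain_le : D.gain i (k + 1) ≤ D.γ' i := by
  have h1 : 1 / √((k : ℝ) + 1) ≤ 1 := by
    rw [div_le_one (by positivity)]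
    exact Real.one_le_sqrt.2 (by linarith [Nat.cast_nonneg (α := ℝ) k])
  refine (le_abs_self _).trans (abs_le_of_sq_le_sq ((D.gain_sq_le i k).trans ?_) (D.γ'_pos i).le)
  exact mul_le_of_le_one_right (sq_nonneg _) h1

/-- The telescoping weight `N + k + 1` cancels one factor of `a²`; what remains has order `√k / k`.
The factor `N' + 1` absorbs the offset in the gain. -/
theorem Design.mul_stepSize_div_gain_sq_le :
    (D.N i + k + 1) * (D.stepSize i (k + 1) / D.gain i (k + 1)) ^ 2 ≤
      D.γ i ^ 2 * (D.N' i + 1) / D.γ' i ^ 2 * (1 / √((k : ℝ) + 1)) := by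
  have hγ' := D.γ'_pos i
  rw [div_pow, D.gain_sq, Design.stepSize]
  push_cast
  rw [← add_assoc]
  set s := √((k : ℝ) + 1)
  have hs : 0 < s := by positivity
  have hs2 : s ^ 2 = k + 1 := Real.sq_sqrt (by positivity)
  have h1 : √((D.N' i : ℝ) + k + 1) ≤ (D.N' i + 1) * s := by
    refine Real.sqrt_le_iff.2 ⟨by positivity, ?_⟩
    rw [mul_pow, hs2]
    have hN := Nat.cast_nonneg (α := ℝ) (D.N' i)
    have hk := Nat.cast_nonneg (α := ℝ) k
    nlinarith [mul_nonneg hN hk, mul_nonneg (mul_nonneg hN hN) hk]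
  have h2 : 1 / ((D.N i : ℝ) + k + 1) ≤ 1 / s ^ 2 := by
    rw [hs2]
    exact one_div_le_one_div_of_le (by positivity)
      (by linarith [Nat.cast_nonneg (α := ℝ) (D.N i)])
  calc ((D.N i : ℝ) + k + 1) * ((D.γ i / (D.N i + k + 1)) ^ 2 /
          (D.γ' i ^ 2 / √((D.N' i : ℝ) + k + 1)))
      = D.γ i ^ 2 / D.γ' i ^ 2 * (√((D.N' i : ℝ) + k + 1) * (1 / ((D.N i : ℝ) + k + 1))) := by
        field_simp
    _ ≤ D.γ i ^ 2 / D.γ' i ^ 2 * (((D.N' i + 1) * s) * (1 / s ^ 2)) := by gcongr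
    _ = D.γ i ^ 2 * (D.N' i + 1) / D.γ' i ^ 2 * (1 / s) := by field_simp

end Rates

/-! ### Constants uniform over the admissible class -/

section Uniform

variable {F : Set (EuclideanSpace ℝ (Fin n))}
  {Θ : Set (Fin K → Matrix (Fin m) (Fin n) ℝ × EuclideanSpace ℝ (Fin m))} {σ : ℝ}
  (D : Design K F) (ystar : EuclideanSpace ℝ (Fin m))

theorem norm_toEuclideanLin_sq_le (A : Matrix (Fin m) (Fin n) ℝ) (v : EuclideanSpace ℝ (Fin n)) :
    ‖A.toEuclideanLin v‖ ^ 2 ≤ (∑ a, ∑ b, A a b ^ 2) * ‖v‖ ^ 2 := by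
  simp only [EuclideanSpace.real_norm_sq_eq, sum_mul]
  refine sum_le_sum fun a _ => ?_
  rw [Matrix.toLpLin_apply]
  simp only [← sum_mul]
  exact sum_mul_sq_le_sq_mul_sq univ (fun b => A a b) fun b => v b

theorem exists_uniform_bound (hΘ : IsCompact Θ) : ∃ Λ B : ℝ, 0 ≤ Λ ∧ 0 ≤ B ∧
    ∀ S : JumpModel K m n, Admissible ystar F Θ σ S → ∀ j,
      (∀ v, ‖(S.A j).toEuclideanLin v‖ ^ 2 ≤ Λ * ‖v‖ ^ 2) ∧ ‖S.b j‖ ≤ B := by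
  let f : (Fin K → Matrix (Fin m) (Fin n) ℝ × EuclideanSpace ℝ (Fin m)) → ℝ := fun θ =>
    ∑ j, ((∑ a, ∑ b, (θ j).1 a b ^ 2) + ‖(θ j).2‖)
  have hf : Continuous f := by fun_prop
  obtain ⟨C, hC⟩ := hΘ.exists_bound_of_continuousOn hf.continuousOn
  have key (S : JumpModel K m n) (hS : Admissible ystar F Θ σ S) (j : Fin K) :
      (∑ a, ∑ b, S.A j a b ^ 2) + ‖S.b j‖ ≤ |C| := by
    have h1 := single_le_sum (f := fun j => (∑ a, ∑ b, S.A j a b ^ 2) + ‖S.b j‖)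
      (fun j _ => by positivity) (mem_univ j)
    exact h1.trans (((le_abs_self _).trans (hC _ hS.mem_Θ)).trans (le_abs_self C))
  have hpos (S : JumpModel K m n) (j : Fin K) : 0 ≤ ∑ a, ∑ b, S.A j a b ^ 2 := by positivity
  refine ⟨|C|, |C|, abs_nonneg C, abs_nonneg C, fun S hS j => ⟨fun v => ?_, ?_⟩⟩
  · refine (norm_toEuclideanLin_sq_le _ v).trans (mul_le_mul_of_nonneg_right ?_ (sq_nonneg _))
    linarith [key S hS j, norm_nonneg (S.b j)]
  · linarith [key S hS j, hpos S j]

/-- Inputs stay in a fixed ball because `F`, the gains and the perturbations are bounded;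
compactness of `Θ` then bounds the mean outputs, and `σ` controls the fourth moment of the noise. -/
theorem exists_outcomeCost_sq_bound (hF : IsCompact F) (hΘ : IsCompact Θ) (i : Fin K) :
    ∃ Q : ℝ, 0 ≤ Q ∧ ∀ S : JumpModel K m n, Admissible ystar F Θ σ S →
      ∀ e ∈ F, ∀ k, ∀ δ : EuclideanSpace ℝ (Fin n), ‖δ‖ ^ 2 ≤ n * D.ξ₁ ^ 2 →
      ∫ o, outcomeCost S ystar (e + D.gain i (k + 1) • δ) o ^ 2 ∂(outcomeLaw S i) ≤ Q ∧
      ∫ o, outcomeCost S ystar (e - D.gain i (k + 1) • δ) o ^ 2 ∂(outcomeLaw S i) ≤ Q := by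
  obtain ⟨Λ, B, hΛ, hB, hbound⟩ := exists_uniform_bound (F := F) (σ := σ) ystar hΘ
  obtain ⟨R, hR⟩ := hF.isBounded.exists_norm_le
  let r : ℝ := R + D.γ' i * √(n * D.ξ₁ ^ 2)
  have hγ' := D.γ'_pos i
  refine ⟨8 * (√Λ * r + B + ‖ystar‖) ^ 4 + 8 * m ^ 2 * σ ^ 4, by positivity,
    fun S hS e he k δ hδ => ?_⟩
  have hv : ‖D.gain i (k + 1) • δ‖ ≤ D.γ' i * √(n * D.ξ₁ ^ 2) := by
    rw [norm_smul, Real.norm_of_nonneg (D.gain_pos i k).le]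
    exact mul_le_mul (D.gain_le i k) (Real.le_sqrt_of_sq_le hδ) (norm_nonneg _) hγ'.le
  have hout {x : EuclideanSpace ℝ (Fin n)} (hx : ‖x‖ ≤ r) (j : Fin K) :
      ‖S.meanOutput j x - ystar‖ ≤ √Λ * r + B + ‖ystar‖ := by
    have h1 : ‖(S.A j).toEuclideanLin x‖ ≤ √Λ * r := by
      refine le_trans ?_ (mul_le_mul_of_nonneg_left hx (Real.sqrt_nonneg Λ))
      refine (le_abs_self _).trans (abs_le_of_sq_le_sq ?_ (by positivity))
      rw [mul_pow, Real.sq_sqrt hΛ]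
      exact (hbound S hS j).1 x
    refine (norm_sub_le _ _).trans (add_le_add_left ?_ _)
    exact (norm_add_le _ _).trans (add_le_add h1 (hbound S hS j).2)
  refine ⟨integral_outcomeCost_sq_le i hS (hout ?_), integral_outcomeCost_sq_le i hS (hout ?_)⟩
  · exact (norm_add_le _ _).trans (add_le_add (hR e he) hv)
  · exact (norm_sub_le _ _).trans (add_le_add (hR e he) hv)

theorem exists_value_initMemory_le (hF : IsCompact F) (hconv : Convex ℝ F) (hΘ : IsCompact Θ)
    (i : Fin K) : ∃ C : ℝ, 0 ≤ C ∧ ∀ S : JumpModel K m n, Admissible ystar F Θ σ S →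
      D.StepSizeCondition S → ∀ T : ℕ,
        value S D ystar i T (D.initMemory i) ≤ ENNReal.ofReal (C * √T) := by
  obtain ⟨Q, hQ0, hQ⟩ := exists_outcomeCost_sq_bound (σ := σ) D ystar hF hΘ i
  obtain ⟨R, hR⟩ := hF.isBounded.exists_norm_le
  have hξ₂ := D.ξ₂_pos
  let g : ℕ → ℝ := fun k =>
    4 * Q * (D.stepSize i (k + 1) / D.gain i (k + 1)) ^ 2 * (n * D.ξ₂)
  -- The recursion starts at `(R + R)²`, which dominates the initial squared error in every model
  -- because the initial estimate and the optimum both lie in `F`.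
  let b : ℕ → ℝ := fun k => Nat.rec ((R + R) ^ 2)
    (fun k x => (D.N i + k) / (D.N i + k + 1) * x + g k) k
  have hb (k : ℕ) : b (k + 1) = (D.N i + k) / (D.N i + k + 1) * b k + g k := rfl
  have hb0 : 0 ≤ b 0 := sq_nonneg _
  let G : ℝ := 4 * Q * (n * D.ξ₂) * (D.γ i ^ 2 * (D.N' i + 1) / D.γ' i ^ 2)
  have hG : 0 ≤ G := by positivity
  have hg (k : ℕ) : (D.N i + k + 1) * g k ≤ G * (1 / √((k : ℝ) + 1)) := by
    have h := mul_le_mul_of_nonneg_left (D.mul_stepSize_div_gain_sq_le i k)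
      (by positivity : 0 ≤ 4 * Q * (n * D.ξ₂))
    calc (D.N i + k + 1) * g k = 4 * Q * (n * D.ξ₂) *
          ((D.N i + k + 1) * (D.stepSize i (k + 1) / D.gain i (k + 1)) ^ 2) := by
          simp only [g]
          ring
      _ ≤ _ := h.trans_eq (by simp only [G]; ring)
  let A : ℝ := 2 * (D.N i * b 0 + 2 * G) + b 0
  let H : ℝ := 4 * D.γ' i ^ 2 * (n * D.ξ₁ ^ 2)
  have hA : 0 ≤ A := by positivity
  have hH : 0 ≤ H := by positivity
  refine ⟨2 * (4 * A + H), by positivity, fun S hS hγ T => ?_⟩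
  obtain ⟨α, β, hα, -, hval, hsum⟩ := exists_value_le (i := i) hF hconv hS hγ (hQ S hS) hQ0
    hb T 0
  -- The bound concerns whole pairs of visits, so `T` visits are majorized by `2T`; this avoids a
  -- case split on parity.
  refine ((value_mono S D ystar i (by omega : T ≤ 2 * T) _).trans
    (hval _ rfl rfl (D.init_mem i))).trans (ENNReal.ofReal_le_ofReal ?_)
  have hinit : ‖D.init i - S.optimalInput ystar i‖ ^ 2 ≤ b 0 :=
    pow_le_pow_left₀ (norm_nonneg _) ((norm_sub_le _ _).trans
      (add_le_add (hR _ (D.init_mem i)) (hR _ (hS.optimalInput_mem i)))) 2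
  calc α * ‖D.init i - S.optimalInput ystar i‖ ^ 2 + β ≤ α * b 0 + β := by gcongr
    _ = ∑ q ∈ range T, (4 * b q + 4 * D.gain i (q + 1) ^ 2 * (n * D.ξ₁ ^ 2)) := by
        simpa only [zero_add] using hsum
    _ ≤ ∑ q ∈ range T, (4 * A + H) * (1 / √((q : ℝ) + 1)) := by
        refine sum_le_sum fun q _ => ?_
        have h1 := le_div_sqrt_of_recursion hG hb0 hb hg q
        have h2 := mul_le_mul_of_nonneg_right (D.gain_sq_le i q)
          (by positivity : 0 ≤ 4 * (n * D.ξ₁ ^ 2))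
        simp only [A, H]
        linarith
    _ ≤ (4 * A + H) * (2 * √T) := by
        rw [← mul_sum]
        exact mul_le_mul_of_nonneg_left (sum_inv_sqrt_le T) (by positivity)
    _ = 2 * (4 * A + H) * √T := by ring

end Uniform

/-! ### Integrability, input error and regret -/

section Performance

variable {F : Set (EuclideanSpace ℝ (Fin n))}
  {Θ : Set (Fin K → Matrix (Fin m) (Fin n) ℝ × EuclideanSpace ℝ (Fin m))} {σ : ℝ}
  {S : JumpModel K m n} {D : Design K F} {ystar : EuclideanSpace ℝ (Fin m)}

variable (S ystar) in
theorem measurable_input_sub_optimal (hF : IsCompact F) (hconv : Convex ℝ F) (t : ℕ) :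
    Measurable fun ω : ℕ → Stage K m n =>
      ((ω t).1, policyInput S D ystar ω t - S.optimalInput ystar (ω t).1) := by
  have hstep : Measurable fun p : Fin K × (Fin K → Memory n) × (Fin n → ℝ) =>
      (p.1, D.input p.1 (p.2.1 p.1) p.2.2 - S.optimalInput ystar p.1) := by
    refine measurable_from_prod_countable_right fun i => ?_
    have h : Measurable fun p : (Fin K → Memory n) × (Fin n → ℝ) => (p.1 i, p.2) := by fun_prop
    have := ((D.measurable_input i).comp h).sub_const (S.optimalInput ystar i)
    exact Measurable.prodMk measurable_const this
  have h1 : Measurable fun ω : ℕ → Stage K m n => (ω t).1 :=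
    measurable_fst.comp (measurable_pi_apply t)
  have h2 : Measurable fun ω : ℕ → Stage K m n => (ω (t + 1)).2.2 :=
    (measurable_snd.comp measurable_snd).comp (measurable_pi_apply (t + 1))
  have h3 := h1.prodMk ((measurable_memory S (D := D) ystar hF hconv t).prodMk h2)
  have := hstep.comp h3
  exact this

variable (S D ystar) in
theorem inputError_nonneg (ω : ℕ → Stage K m n) (T : ℕ) : 0 ≤ inputError S D ystar ω T :=
  sum_nonneg fun _ _ => sq_nonneg _

theorem measurable_inputError (hF : IsCompact F) (hconv : Convex ℝ F) (T : ℕ) :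
    Measurable fun ω => inputError S D ystar ω T :=
  Finset.measurable_sum _ fun t _ =>
    ((measurable_snd.comp (measurable_input_sub_optimal S ystar hF hconv t)).norm.pow_const 2 :)

theorem integrable_inputError (hF : IsCompact F) (hconv : Convex ℝ F) {T : ℕ} {C : ℝ}
    (h : ∫⁻ ω, ENNReal.ofReal (inputError S D ystar ω T) ∂(law S D) ≤ ENNReal.ofReal C) :
    Integrable (fun ω => inputError S D ystar ω T) (law S D) := by
  refine ⟨(measurable_inputError hF hconv T).aestronglyMeasurable, ?_⟩
  rw [hasFiniteIntegral_iff_ofReal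
    (Filter.Eventually.of_forall fun ω => inputError_nonneg S D ystar ω T)]
  exact h.trans_lt ENNReal.ofReal_lt_top

theorem inputMSE_le (hF : IsCompact F) (hconv : Convex ℝ F) {T : ℕ} {C : ℝ} (hC : 0 ≤ C)
    (h : ∫⁻ ω, ENNReal.ofReal (inputError S D ystar ω T) ∂(law S D) ≤ ENNReal.ofReal C) :
    inputMSE D ystar T S ≤ C := by
  rw [inputMSE, ← ENNReal.ofReal_le_ofReal_iff hC, ofReal_integral_eq_lintegral_ofReal
    (integrable_inputError hF hconv h)
    (Filter.Eventually.of_forall fun ω => inputError_nonneg S D ystar ω T)]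
  exact h

theorem excessCost_eq (hS : Admissible ystar F Θ σ S) (ω : ℕ → Stage K m n) (T : ℕ) :
    excessCost S D ystar ω T = ∑ t ∈ range T, ∑ j, S.P (ω t).1 j *
      ‖(S.A j).toEuclideanLin (policyInput S D ystar ω t - S.optimalInput ystar (ω t).1)‖ ^ 2 := by
  rw [excessCost, ← sum_sub_distrib]
  exact sum_congr rfl fun t _ => stageCost_sub_optimal _ hS _

theorem measurable_excessCost (hF : IsCompact F) (hconv : Convex ℝ F)
    (hS : Admissible ystar F Θ σ S) (T : ℕ) :
    Measurable fun ω => excessCost S D ystar ω T := by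
  have hq : Measurable fun p : Fin K × EuclideanSpace ℝ (Fin n) =>
      ∑ j, S.P p.1 j * ‖(S.A j).toEuclideanLin p.2‖ ^ 2 := by
    refine measurable_from_prod_countable_right fun i => ?_
    refine Finset.measurable_sum _ fun j _ => ?_
    have : Continuous (S.A j).toEuclideanLin := LinearMap.continuous_of_finiteDimensional _
    exact ((this.measurable.norm.pow_const 2).const_mul (S.P i j) :)
  simp only [excessCost_eq hS]
  exact Finset.measurable_sum _ fun t _ =>
    (hq.comp (measurable_input_sub_optimal S ystar hF hconv t) :)

theorem excessCost_nonneg (hS : Admissible ystar F Θ σ S) (ω : ℕ → Stage K m n) (T : ℕ) :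
    0 ≤ excessCost S D ystar ω T := by
  rw [excessCost_eq hS]
  exact sum_nonneg fun t _ => sum_nonneg fun j _ => mul_nonneg (S.P_nonneg _ j) (sq_nonneg _)

theorem excessCost_le (hS : Admissible ystar F Θ σ S) {Λ : ℝ}
    (hΛ : ∀ j v, ‖(S.A j).toEuclideanLin v‖ ^ 2 ≤ Λ * ‖v‖ ^ 2) (ω : ℕ → Stage K m n) (T : ℕ) :
    excessCost S D ystar ω T ≤ Λ * inputError S D ystar ω T := by
  rw [excessCost_eq hS, inputError, mul_sum]
  refine sum_le_sum fun t _ => ?_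
  refine (sum_le_sum fun j _ => mul_le_mul_of_nonneg_left (hΛ j _) (S.P_nonneg _ j)).trans_eq ?_
  rw [← sum_mul, S.P_sum, one_mul]

theorem integrable_excessCost (hF : IsCompact F) (hconv : Convex ℝ F)
    (hS : Admissible ystar F Θ σ S) {Λ : ℝ}
    (hΛ : ∀ j v, ‖(S.A j).toEuclideanLin v‖ ^ 2 ≤ Λ * ‖v‖ ^ 2) {T : ℕ}
    (h : Integrable (fun ω => inputError S D ystar ω T) (law S D)) :
    Integrable (fun ω => excessCost S D ystar ω T) (law S D) := by
  refine (h.const_mul Λ).mono' (measurable_excessCost hF hconv hS T).aestronglyMeasurable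
    (Filter.Eventually.of_forall fun ω => ?_)
  rw [Real.norm_of_nonneg (excessCost_nonneg hS ω T)]
  exact excessCost_le hS hΛ ω T

theorem regret_le (hF : IsCompact F) (hconv : Convex ℝ F)
    (hS : Admissible ystar F Θ σ S) {Λ : ℝ}
    (hΛ : ∀ j v, ‖(S.A j).toEuclideanLin v‖ ^ 2 ≤ Λ * ‖v‖ ^ 2) {T : ℕ}
    (h : Integrable (fun ω => inputError S D ystar ω T) (law S D)) :
    regret D ystar T S ≤ Λ * inputMSE D ystar T S := by
  rw [regret, inputMSE, ← integral_const_mul]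
  exact integral_mono (integrable_excessCost hF hconv hS hΛ h) (h.const_mul Λ)
    fun ω => excessCost_le hS hΛ ω T

end Performance

end MSPSA

end

theorem mainTheorem1 {K m n : ℕ}
    (ystar : EuclideanSpace ℝ (Fin m))
    (F : Set (EuclideanSpace ℝ (Fin n))) (hF_compact : IsCompact F) (hF_convex : Convex ℝ F)
    (Θ : Set (Fin K → Matrix (Fin m) (Fin n) ℝ × EuclideanSpace ℝ (Fin m)))
    (hΘ : IsCompact Θ)
    (σ : ℝ) (hσ : 0 < σ)
    (D : MSPSA.Design K F) :
    ∃ C C' : ℝ, 0 < C ∧ 0 < C' ∧ ∀ T : ℕ,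
      (∀ S : MSPSA.JumpModel K m n,
        MSPSA.Admissible ystar F Θ σ S → D.StepSizeCondition S →
          Integrable (fun ω => MSPSA.inputError S D ystar ω T) (MSPSA.law S D) ∧
          Integrable (fun ω => MSPSA.excessCost S D ystar ω T) (MSPSA.law S D)) ∧
      MSPSA.worstCase {S | MSPSA.Admissible ystar F Θ σ S ∧ D.StepSizeCondition S}
        (MSPSA.inputMSE D ystar T) ≤ ((C * Real.sqrt T : ℝ) : EReal) ∧
      MSPSA.worstCase {S | MSPSA.Admissible ystar F Θ σ S ∧ D.StepSizeCondition S}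
        (MSPSA.regret D ystar T) ≤ ((C' * Real.sqrt T : ℝ) : EReal) := by
  classical
  choose C₀ hC₀ hval using fun i =>
    MSPSA.exists_value_initMemory_le (Θ := Θ) (σ := σ) D ystar hF_compact hF_convex hΘ i
  obtain ⟨Λ, _, hΛ, _, hbound⟩ := MSPSA.exists_uniform_bound (F := F) (σ := σ) ystar hΘ
  have hC : 0 ≤ ∑ i, C₀ i := Finset.sum_nonneg fun i _ => hC₀ i
  have hmain (S : MSPSA.JumpModel K m n) (hS : MSPSA.Admissible ystar F Θ σ S)
      (hγ : D.StepSizeCondition S) (T : ℕ) :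
      ∫⁻ ω, ENNReal.ofReal (MSPSA.inputError S D ystar ω T) ∂(MSPSA.law S D) ≤
        ENNReal.ofReal ((∑ i, C₀ i) * √T) := by
    refine (MSPSA.lintegral_inputError_le S ystar hF_compact hF_convex T).trans ?_
    rw [Finset.sum_mul, ENNReal.ofReal_sum_of_nonneg fun i _ =>
      mul_nonneg (hC₀ i) (Real.sqrt_nonneg _)]
    exact Finset.sum_le_sum fun i _ => hval i S hS hγ T
  have hmse (S : MSPSA.JumpModel K m n) (hS : MSPSA.Admissible ystar F Θ σ S)
      (hγ : D.StepSizeCondition S) (T : ℕ) :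
      MSPSA.inputMSE D ystar T S ≤ (∑ i, C₀ i) * √T :=
    MSPSA.inputMSE_le hF_compact hF_convex (by positivity) (hmain S hS hγ T)
  -- Adding one makes the constants strictly positive, since the sums and `Λ` may vanish.
  refine ⟨∑ i, C₀ i + 1, Λ * (∑ i, C₀ i) + 1, by positivity, by positivity, fun T => ⟨?_, ?_, ?_⟩⟩
  · intro S hS hγ
    have hint := MSPSA.integrable_inputError hF_compact hF_convex (hmain S hS hγ T)
    exact ⟨hint, MSPSA.integrable_excessCost hF_compact hF_convex hS
      (fun j => (hbound S hS j).1) hint⟩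
  · refine iSup₂_le fun S hS => EReal.coe_le_coe_iff.2 ((hmse S hS.1 hS.2 T).trans ?_)
    nlinarith [Real.sqrt_nonneg (T : ℝ)]
  · refine iSup₂_le fun S hS => EReal.coe_le_coe_iff.2 ?_
    have hint := MSPSA.integrable_inputError hF_compact hF_convex (hmain S hS.1 hS.2 T)
    refine (MSPSA.regret_le hF_compact hF_convex hS.1 (fun j => (hbound S hS.1 j).1) hint).trans ?_
    have := mul_le_mul_of_nonneg_left (hmse S hS.1 hS.2 T) hΛ
    nlinarith [Real.sqrt_nonneg (T : ℝ)]
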